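/- Let $\mu$ be the surface measure on the unit sphere $\mathbb S^2\subset\mathbb R^3$ (total mass $4\pi$), let $P_\ell$ be the Legendre polynomials with $P_\ell(1)=1$, and put $\lambda_\ell=\ell(\ell+1)$. For each $\ell\ge 0$ let $Y_{\ell,1},\dots,Y_{\ell,2\ell+1}$ be a real $L_2(\mathbb S^2,\mu)$-orthonormal basis of the spherical harmonics of degree $\ell$, and for $\ell\ge1$ put $\mathbf y_{\ell,k}=\lambda_\ell^{-1/2}\,x\times\nabla_*Y_{\ell,k}$ and $\mathbf z_{\ell,k}=\lambda_\ell^{-1/2}\,\nabla_*Y_{\ell,k}$, where $\nabla_*$ is the surface gradient. For real $\sigma\ge 0$ let $\mathbf H^\sigma(\mathbb S^2)$ be the space of square-integrable tangential vector fields $\mathbf f:\mathbb S^2\to\mathbb R^3$ with $$\|\mathbf f\|_{\mathbf H^\sigma}^2=\sum_{\ell=1}^\infty\sum_{k=1}^{2\ell+1}(1+\lambda_\ell)^\sigma\bigl(|\langle \mathbf f,\mathbf y_{\ell,k}\rangle|^2+|\langle \mathbf f,\mathbf z_{\ell,k}\rangle|^2\bigr)<\infty,\qquad \langle\mathbf f,\mathbf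 g\rangle=\int_{\mathbb S^2}\mathbf f^\top\mathbf g\,d\mu .$$ Let $\phi\in C[0,\infty)$, and for every $\rho\in(0,1)$ let $\psi_\rho(x\cdot y)=C_{\psi,\rho}\,\phi(\rho^{-1}\|x-y\|)$ for $x,y\in\mathbb S^2$, where the constant $C_{\psi,\rho}$ is such that $\int_{\mathbb S^2}\psi_\rho(x\cdot y)\,d\mu(x)=1$. Put $\widehat\psi_\rho(\ell)=2\pi\int_{-1}^1\psi_\rho(t)P_\ell(t)\,dt$ and $\ell_\rho=\lfloor\rho^{-1}-1\rfloor$. Let $0\le\tau\le\sigma\le m$ and assume that there are $0<\rho_0<1$ and $c_1,c_2>0$ such that $$|1-\widehat\psi_\rho(\ell)|\le c_1(\ell\rho)^m\quad(0<\rho<\rho_0,\ 0\le\ell\le\ell_\rho),\qquad |\widehat\psi_\rho(\ell)|\le c_2\quad(0<\rho<1,\ \ell>\ell_\rho).$$ For $t\in(-1,1)$ let $\kappa_\rho(t)=\frac1{4\pi(1-t^2)}\int_{-1}^t(1-4\pi\psi_\rho(s))\,ds$, extended continuously to $[-1,1]$. With $t=x\cdot y$ let $$\Psi_\rho(x,y)=\kappa_\rho'(t)\,\mathbf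 Q+\kappa_\rho(t)\,\mathbf R+\kappa_\rho'(t)\,\mathbf V+\kappa_\rho(t)\,\mathbf W,$$ $$\mathbf Q=-(x\times y)(x\times y)^\top,\quad \mathbf R=t\mathbf I-yx^\top,\quad \mathbf V=(y-tx)(x-ty)^\top,\quad \mathbf W=(\mathbf I-xx^\top)(\mathbf I-yy^\top),$$ where the terms with $\kappa_\rho'$ are read as $0$ if $x=\pm y$, and let $(\mathcal C_{\Psi_\rho}\mathbf f)(x)=\int_{\mathbb S^2}\Psi_\rho(x,y)\,\mathbf f(y)\,d\mu(y)$. Then there is a constant $C>0$, independent of $\rho$ and $\mathbf f$, such that for all $\rho\in(0,1)$ and all $\mathbf f\in\mathbf H^\sigma(\mathbb S^2)$ the integrals defining $\mathcal C_{\Psi_\rho}\mathbf f$ and $\mathcal C_{\Psi_\rho}^2\mathbf f=\mathcal C_{\Psi_\rho}(\mathcal C_{\Psi_\rho}\mathbf f)$ converge absolutely at every point of $\mathbb S^2$, $\mathcal C_{\Psi_\rho}\mathbf f$ is a square-integrable tangential field, $\mathcal C_{\Psi_\rho}\mathbf f-\mathcal C_{\Psi_\rho}^2\mathbf f\in\mathbf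 H^\tau(\mathbb S^2)$, and $$\|\mathcal C_{\Psi_\rho}\mathbf f-\mathcal C_{\Psi_\rho}^2\mathbf f\|_{\mathbf H^\tau(\mathbb S^2)}\le C\,\rho^{\sigma-\tau}\,\|\mathbf f\|_{\mathbf H^\sigma(\mathbb S^2)} .$$ -/

import Mathlib

open MeasureTheory Set
open scoped Matrix ENNReal

noncomputable section

namespace SphereQI

/-- Euclidean three-space. -/
abbrev E3 : Type := EuclideanSpace ℝ (Fin 3)

/-- The unit sphere `𝕊²` in `ℝ³`. -/
abbrev S2 : Type := Metric.sphere (0 : E3) 1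

/-- The rotation-invariant surface measure on `𝕊²` (total mass `4π`). -/
def surfaceMeasure : Measure S2 := (volume : Measure E3).toSphere

/-- The cross product on `E3`. -/
def cross (v w : E3) : E3 := WithLp.toLp 2 (WithLp.ofLp v ⨯₃ WithLp.ofLp w)

/-! ### Surface gradient and surface curl -/

/-- The extension of `u : 𝕊² → ℝ` to `ℝ³ \ {0}` that is constant along rays. -/
def radialExtension (u : S2 → ℝ) (v : E3) : ℝ :=
  if h : v = 0 then 0
  else u ⟨‖v‖⁻¹ • v, by
    have hv : ‖v‖ ≠ 0 := norm_ne_zero_iff.mpr h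
    simp [norm_smul, hv]⟩

/-- The surface gradient `∇_* u`: the Euclidean gradient, at points of the sphere, of the
extension of `u` that is constant along rays. -/
def surfaceGrad (u : S2 → ℝ) (x : S2) : E3 := gradient (radialExtension u) (x : E3)

/-- The surface curl `L_* u = x × ∇_* u`. -/
def surfaceCurl (u : S2 → ℝ) (x : S2) : E3 := cross (x : E3) (surfaceGrad u x)

/-! ### Spherical harmonics -/

/-- The spherical harmonics of degree `ℓ`: restrictions to the sphere of real harmonic
homogeneous polynomials of degree `ℓ` in three variables. -/
def sphericalHarmonics (ℓ : ℕ) : Set (S2 → ℝ) :=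
  {u | ∃ p : MvPolynomial (Fin 3) ℝ, p.IsHomogeneous ℓ ∧
    ∑ i, MvPolynomial.pderiv i (MvPolynomial.pderiv i p) = 0 ∧
    ∀ x : S2, u x = MvPolynomial.eval (fun i => (x : E3) i) p}

/-- `Y ℓ k`, `k = 1, …, 2ℓ+1`, is an `L₂(𝕊²)`-orthonormal basis of the space of spherical
harmonics of degree `ℓ`, for every `ℓ`. -/
structure IsSphericalHarmonicBasis (Y : (ℓ : ℕ) → Fin (2 * ℓ + 1) → S2 → ℝ) : Prop where
  span_eq : ∀ ℓ, (Submodule.span ℝ (range (Y ℓ)) : Set (S2 → ℝ)) = sphericalHarmonics ℓ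
  orthonormal : ∀ ℓ j k, ∫ x, Y ℓ j x * Y ℓ k x ∂surfaceMeasure = if j = k then 1 else 0

/-- The Laplace–Beltrami eigenvalue `λ_ℓ = ℓ(ℓ+1)`. -/
def eigenvalue (ℓ : ℕ) : ℝ := ℓ * (ℓ + 1)

/-- The divergence-free vector spherical harmonic `y_{ℓ,k} = L_* Y_{ℓ,k} / √(ℓ(ℓ+1))`. -/
def harmonicDiv (Y : (ℓ : ℕ) → Fin (2 * ℓ + 1) → S2 → ℝ) (ℓ : ℕ) (k : Fin (2 * ℓ + 1))
    (x : S2) : E3 :=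
  (√(eigenvalue ℓ))⁻¹ • surfaceCurl (Y ℓ k) x

/-- The curl-free vector spherical harmonic `z_{ℓ,k} = ∇_* Y_{ℓ,k} / √(ℓ(ℓ+1))`. -/
def harmonicCurl (Y : (ℓ : ℕ) → Fin (2 * ℓ + 1) → S2 → ℝ) (ℓ : ℕ) (k : Fin (2 * ℓ + 1))
    (x : S2) : E3 :=
  (√(eigenvalue ℓ))⁻¹ • surfaceGrad (Y ℓ k) x

/-! ### Tangential vector fields and their Sobolev norms -/

/-- The inner product `⟨f, g⟩ = ∫ f(x)ᵀ g(x) dμ(x)` of vector fields. -/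
def fieldInner (f g : S2 → E3) : ℝ := ∫ x, inner ℝ (f x) (g x) ∂surfaceMeasure

/-- `f` represents an element of the space of square-integrable tangential vector fields. -/
def IsL2Tangential (f : S2 → E3) : Prop :=
  MemLp f 2 surfaceMeasure ∧ ∀ᵐ x : S2 ∂surfaceMeasure, inner ℝ (x : E3) (f x) = 0

/-- The Sobolev norm
`(∑_{ℓ ≥ 1} ∑_k (1+λ_ℓ)^σ (|⟨f, y_{ℓ,k}⟩|² + |⟨f, z_{ℓ,k}⟩|²))^{1/2}`, possibly infinite. -/
def sobolevENorm (Y : (ℓ : ℕ) → Fin (2 * ℓ + 1) → S2 → ℝ) (σ : ℝ) (f : S2 → E3) : ℝ≥0∞ :=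
  (∑' ℓ : ℕ+, ∑ k : Fin (2 * (ℓ : ℕ) + 1),
    ENNReal.ofReal ((1 + eigenvalue ℓ) ^ σ *
      (fieldInner f (harmonicDiv Y ℓ k) ^ 2 + fieldInner f (harmonicCurl Y ℓ k) ^ 2)))
    ^ (1 / 2 : ℝ)

/-- Membership in the vector Sobolev space `H^σ(𝕊²)`. -/
def MemSobolev (Y : (ℓ : ℕ) → Fin (2 * ℓ + 1) → S2 → ℝ) (σ : ℝ) (f : S2 → E3) : Prop :=
  IsL2Tangential f ∧ sobolevENorm Y σ f < ∞

/-- The Sobolev norm as a real number, meaningful for members of `H^σ(𝕊²)`. -/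
def sobolevNorm (Y : (ℓ : ℕ) → Fin (2 * ℓ + 1) → S2 → ℝ) (σ : ℝ) (f : S2 → E3) : ℝ :=
  (sobolevENorm Y σ f).toReal

/-! ### Zonal kernels -/

/-- The Legendre polynomial `P_ℓ`, by Rodrigues' formula (so `P_ℓ(1) = 1`). -/
def legendre (ℓ : ℕ) : Polynomial ℝ :=
  Polynomial.C ((2 ^ ℓ * (ℓ.factorial : ℝ))⁻¹) *
    Polynomial.derivative^[ℓ] ((Polynomial.X ^ 2 - 1) ^ ℓ)

/-- The Fourier–Legendre coefficient `ψ̂(ℓ) = 2π ∫_{-1}^1 ψ(t) P_ℓ(t) dt`, which is the one that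
makes `ψ(x·y) = ∑_ℓ (2ℓ+1)/(4π) ψ̂(ℓ) P_ℓ(x·y) = ∑_ℓ ψ̂(ℓ) ∑_k Y_{ℓ,k}(x) Y_{ℓ,k}(y)`. -/
def zonalCoeff (ψ : ℝ → ℝ) (ℓ : ℕ) : ℝ :=
  2 * Real.pi * ∫ t in (-1 : ℝ)..1, ψ t * (legendre ℓ).eval t

/-- The zonal profile at scale `ρ`: for `t = x·y` with `x, y ∈ 𝕊²` one has
`√(2 - 2t) = ‖x - y‖`, so this is `c(ρ) φ(ρ⁻¹ ‖x - y‖)`. -/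
def scaledZonal (φ c : ℝ → ℝ) (ρ t : ℝ) : ℝ := c ρ * φ (ρ⁻¹ * √(2 - 2 * t))

/-- `c ρ` is the normalizing constant: `∫ ψ_ρ(x·y) dμ(x) = 1` for all `ρ ∈ (0,1)`. -/
def IsNormalizing (φ c : ℝ → ℝ) : Prop :=
  ∀ ρ, 0 < ρ → ρ < 1 → ∀ y : S2,
    ∫ x : S2, scaledZonal φ c ρ (inner ℝ (x : E3) (y : E3)) ∂surfaceMeasure = 1

/-- The assumption of order `m` on the Fourier–Legendre coefficients of the scaled family `ψ`:
with `ℓ_ρ = ⌊ρ⁻¹ - 1⌋`, one has `|1 - ψ̂_ρ(ℓ)| ≤ c₁ (ℓρ)^m` for `0 < ρ < ρ₀` and `ℓ ≤ ℓ_ρ`,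
and the coefficients with `ℓ > ℓ_ρ` are bounded by `c₂`. -/
def KernelAssumption (ψ : ℝ → ℝ → ℝ) (m : ℝ) : Prop :=
  ∃ ρ₀ c₁ c₂ : ℝ, 0 < ρ₀ ∧ ρ₀ < 1 ∧ 0 < c₁ ∧ 0 < c₂ ∧
    (∀ ρ, 0 < ρ → ρ < ρ₀ → ∀ ℓ : ℕ, ℓ ≤ ⌊ρ⁻¹ - 1⌋₊ →
      |1 - zonalCoeff (ψ ρ) ℓ| ≤ c₁ * ((ℓ : ℝ) * ρ) ^ m) ∧
    (∀ ρ, 0 < ρ → ρ < 1 → ∀ ℓ : ℕ, ⌊ρ⁻¹ - 1⌋₊ < ℓ → |zonalCoeff (ψ ρ) ℓ| ≤ c₂)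

/-! ### The divergence-free and curl-free matrix kernels -/

/-- The auxiliary function `κ(t) = (4π(1-t²))⁻¹ ∫_{-1}^t (1 - 4πψ(s)) ds` on `(-1,1)`, extended
to `±1` by its limits. -/
def kappa (ψ : ℝ → ℝ) : ℝ → ℝ :=
  extendFrom (Ioo (-1) 1) fun t =>
    (∫ s in (-1 : ℝ)..t, (1 - 4 * Real.pi * ψ s)) / (4 * Real.pi * (1 - t ^ 2))

/-- The column vector `v` times the row vector `wᵀ`. -/
def outer (v w : E3) : Matrix (Fin 3) (Fin 3) ℝ :=
  Matrix.vecMulVec (WithLp.ofLp v) (WithLp.ofLp w)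

/-- `Q(x,y) = -(x × y)(x × y)ᵀ`. -/
def matQ (x y : E3) : Matrix (Fin 3) (Fin 3) ℝ := -outer (cross x y) (cross x y)

/-- `R(x,y) = t I - y xᵀ`, where `t = x·y`. -/
def matR (x y : E3) : Matrix (Fin 3) (Fin 3) ℝ := inner ℝ x y • 1 - outer y x

/-- `V(x,y) = (y - t x)(x - t y)ᵀ`, where `t = x·y`. -/
def matV (x y : E3) : Matrix (Fin 3) (Fin 3) ℝ :=
  outer (y - inner ℝ x y • x) (x - inner ℝ x y • y)

/-- `W(x,y) = (I - x xᵀ)(I - y yᵀ)`. -/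
def matW (x y : E3) : Matrix (Fin 3) (Fin 3) ℝ := (1 - outer x x) * (1 - outer y y)

/-- The divergence-free kernel `κ'(t) Q + κ(t) R`. For `x = ± y` the matrix `Q` vanishes, so the
value of the derivative at `t = ±1` is immaterial. -/
def kernelDiv (ψ : ℝ → ℝ) (x y : E3) : Matrix (Fin 3) (Fin 3) ℝ :=
  deriv (kappa ψ) (inner ℝ x y) • matQ x y + kappa ψ (inner ℝ x y) • matR x y

/-- The curl-free kernel `κ'(t) V + κ(t) W`. For `x = ± y` the matrix `V` vanishes, so the
value of the derivative at `t = ±1` is immaterial. -/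
def kernelCurl (ψ : ℝ → ℝ) (x y : E3) : Matrix (Fin 3) (Fin 3) ℝ :=
  deriv (kappa ψ) (inner ℝ x y) • matV x y + kappa ψ (inner ℝ x y) • matW x y

/-- The combined matrix kernel `Ψ = Ψ^div + Ψ^curl`. -/
def kernel (ψ : ℝ → ℝ) (x y : E3) : Matrix (Fin 3) (Fin 3) ℝ :=
  kernelDiv ψ x y + kernelCurl ψ x y

/-- The integrand `Ψ(x,y) f(y)` of the convolution operator. -/
def convIntegrand (ψ : ℝ → ℝ) (f : S2 → E3) (x y : S2) : E3 :=
  WithLp.toLp 2 (kernel ψ (x : E3) (y : E3) *ᵥ WithLp.ofLp (f y))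

/-- The convolution operator `(C_Ψ f)(x) = ∫ Ψ(x,y) f(y) dμ(y)`. -/
def conv (ψ : ℝ → ℝ) (f : S2 → E3) (x : S2) : E3 :=
  ∫ y, convIntegrand ψ f x y ∂surfaceMeasure

/-- The integral defining `C_Ψ f` converges absolutely at every point of the sphere. -/
def ConvDefined (ψ : ℝ → ℝ) (f : S2 → E3) : Prop :=
  ∀ x : S2, Integrable (convIntegrand ψ f x) surfaceMeasure

end SphereQI

end

noncomputable section

namespace SphereQI

/-! ### Polynomials in three variables -/

/-! The convolution operator `C` is diagonal: every vector spherical harmonic of degree `ℓ ≥ 1`, of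
either type, is an eigenfield with the scalar coefficient `ψ̂(ℓ)` as eigenvalue
(`IsProfile.conv_harmonicDiv`, `IsProfile.conv_harmonicCurl`). Since `C` is also symmetric
(`IsProfile.fieldInner_conv`), it can be moved onto the harmonics, so the coefficients of `C f - C²
f` are those of `f` times `ψ̂(ℓ)(1 - ψ̂(ℓ))`. No expansion of `f`, hence no completeness of the
harmonics, is needed, because the Sobolev norm is defined by coefficients. The theorem becomes the
multiplier bound `IsNormalizing.exists_multiplier_le`, inserted termwise by `sobolevENorm_le_mul`.

Multipliers, with `a = σ - τ`: at low frequencies `1 - ψ̂` is at most a multiple of `(ℓρ)^m ≤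
(ℓρ)^a` and `ψ̂` is bounded; otherwise `ρ²(1 + λ_ℓ)` is bounded below and boundedness of `ψ̂`
suffices. For `ρ ≥ ρ₀` and low degree the hypotheses give no bound on `ψ̂`, but only finitely many
degrees and a compact range of `ρ` remain, and continuity in `ρ` settles them.

Diagonalization: let `A = x × ∇`. If `g' = κ`, the matrix `κ'Q + κR` consists of minus the second
angular derivatives, in `y`, of `g(x·y)`. Two integrations by parts put both derivatives on the
field `F`, leaving `-∫ g(x·y) A_i (∑ A_j F_j)`. For a surface gradient the inner sum vanishes. For a
curl field `A p` it is `-λ_ℓ p`, and the definition of `κ` makes the Laplace–Beltrami image of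
`g(x·y)` equal to `1/(4π) - ψ`, so Funk–Hecke for `ψ` gives `ψ̂(ℓ) A_i p`. The curl-free kernel is
the divergence-free one conjugated by cross products, which interchange the two types.

This is carried out for polynomial profiles, where everything is an identity about polynomials and a
rotation-invariant functional, and extended to continuous profiles by uniform approximation with the
integral kept fixed. -/

/-- Real polynomials in three variables. -/
abbrev Poly : Type := MvPolynomial (Fin 3) ℝ

/-- The value of a polynomial at a point of Euclidean three-space. -/
def peval (p : Poly) (x : E3) : ℝ := MvPolynomial.eval (fun i => x i) p

@[simp] lemma peval_add (p q : Poly) (x : E3) : peval (p + q) x = peval p x + peval q x := by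
  simp [peval]

@[simp] lemma peval_sub (p q : Poly) (x : E3) : peval (p - q) x = peval p x - peval q x := by
  simp [peval]

@[simp] lemma peval_neg (p : Poly) (x : E3) : peval (-p) x = -peval p x := by
  simp [peval]

@[simp] lemma peval_mul (p q : Poly) (x : E3) : peval (p * q) x = peval p x * peval q x := by
  simp [peval]

@[simp] lemma peval_pow (p : Poly) (n : ℕ) (x : E3) : peval (p ^ n) x = peval p x ^ n := by
  simp [peval]

@[simp] lemma peval_C (c : ℝ) (x : E3) : peval (MvPolynomial.C c) x = c := by
  simp [peval]

@[simp] lemma peval_smul (c : ℝ) (p : Poly) (x : E3) : peval (c • p) x = c * peval p x := by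
  simp [peval, MvPolynomial.smul_eval]

@[simp] lemma peval_X (i : Fin 3) (x : E3) : peval (MvPolynomial.X i) x = x i := by
  simp [peval]

@[simp] lemma peval_zero (x : E3) : peval 0 x = 0 := by simp [peval]

@[simp] lemma peval_one (x : E3) : peval 1 x = 1 := by simp [peval]

@[simp] lemma peval_sum {ι : Type*} (s : Finset ι) (p : ι → Poly) (x : E3) :
    peval (∑ i ∈ s, p i) x = ∑ i ∈ s, peval (p i) x := by
  simp [peval]

lemma peval_smul_of_isHomogeneous {p : Poly} {ℓ : ℕ} (hp : p.IsHomogeneous ℓ) (r : ℝ) (x : E3) :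
    peval p (r • x) = r ^ ℓ * peval p x := by
  simp only [peval, MvPolynomial.eval_eq, PiLp.smul_apply, smul_eq_mul, mul_pow, Finset.mul_sum]
  refine Finset.sum_congr rfl fun d hd => ?_
  have h : d.degree = ℓ := by
    have := hp (MvPolynomial.mem_support_iff.1 hd)
    have h0 : d.degree = Finsupp.weight 1 d := by
      rw [Finsupp.degree_eq_weight_one]; rfl
    rw [← h0] at this
    exact this
  rw [Finset.prod_mul_distrib, Finset.prod_pow_eq_pow_sum, ← Finsupp.degree_apply, h]
  ring

lemma hasFDerivAt_peval (p : Poly) (x : E3) :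
    HasFDerivAt (peval p)
      (∑ i, peval (MvPolynomial.pderiv i p) x • (EuclideanSpace.proj i : E3 →L[ℝ] ℝ)) x := by
  induction p using MvPolynomial.induction_on with
  | C a =>
    have : peval (MvPolynomial.C a) = fun _ => a := by ext; simp
    rw [this]
    simpa using hasFDerivAt_const a x
  | add p q hp hq =>
    have : peval (p + q) = fun x => peval p x + peval q x := by ext; simp
    rw [this]
    refine (hp.add hq).congr_fderiv ?_
    simp [add_smul, Finset.sum_add_distrib]
  | mul_X p j hp =>
    have : peval (p * MvPolynomial.X j) =
        fun x => peval p x * (EuclideanSpace.proj j : E3 →L[ℝ] ℝ) x := by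
      ext; simp
    rw [this]
    refine (hp.mul (EuclideanSpace.proj j : E3 →L[ℝ] ℝ).hasFDerivAt).congr_fderiv ?_
    simp only [MvPolynomial.pderiv_mul, MvPolynomial.pderiv_X, peval_add, peval_mul, add_smul,
      Finset.sum_add_distrib, peval_X, mul_smul, Finset.smul_sum]
    rw [add_comm]
    congr 1
    · refine Finset.sum_congr rfl fun i _ => ?_
      simp [smul_smul, mul_comm]
    · rw [Finset.sum_eq_single j] <;> simp +contextual [eq_comm]

lemma continuous_peval (p : Poly) : Continuous (peval p) :=
  continuous_iff_continuousAt.2 fun x => (hasFDerivAt_peval p x).continuousAt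

/-! ### Angular derivatives -/

/-- The angular derivative `x_{i+1} ∂_{i+2} - x_{i+2} ∂_{i+1}`, the `i`-th component of `x × ∇`. -/
def angular (i : Fin 3) : Derivation ℝ Poly Poly :=
  (MvPolynomial.X (i + 1) : Poly) • MvPolynomial.pderiv (i + 2) -
    (MvPolynomial.X (i + 2) : Poly) • MvPolynomial.pderiv (i + 1)

lemma angular_apply (i : Fin 3) (p : Poly) :
    angular i p = MvPolynomial.X (i + 1) * MvPolynomial.pderiv (i + 2) p -
      MvPolynomial.X (i + 2) * MvPolynomial.pderiv (i + 1) p := by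
  simp [angular]

/-! ### Rotations, invariance of the surface measure and integration by parts. -/

/-- Rotation by the angle `θ` about the `i`-th coordinate axis, as a linear map. -/
def rotationLin (i : Fin 3) (θ : ℝ) : E3 →ₗ[ℝ] E3 where
  toFun x := WithLp.toLp 2 fun j =>
    if j = i + 1 then Real.cos θ * x (i + 1) - Real.sin θ * x (i + 2)
    else if j = i + 2 then Real.sin θ * x (i + 1) + Real.cos θ * x (i + 2) else x j
  map_add' x y := by
    ext j
    simp only [PiLp.add_apply]
    split_ifs <;> ring
  map_smul' r x := by
    ext j
    simp only [PiLp.smul_apply, smul_eq_mul, RingHom.id_apply]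
    split_ifs <;> ring

/-- Rotation by the angle `θ` about the `i`-th coordinate axis. -/
def rotation (i : Fin 3) (θ : ℝ) : E3 ≃ₗᵢ[ℝ] E3 :=
  LinearIsometry.toLinearIsometryEquiv
    { rotationLin i θ with
      norm_map' := fun x => by
        rw [EuclideanSpace.norm_eq, EuclideanSpace.norm_eq]
        congr 1
        have h := Real.sin_sq_add_cos_sq θ
        fin_cases i <;> simp [rotationLin, Fin.sum_univ_three]
        · linear_combination (x 1 ^ 2 + x 2 ^ 2) * h
        · linear_combination (x 0 ^ 2 + x 2 ^ 2) * h
        · linear_combination (x 0 ^ 2 + x 1 ^ 2) * h } rfl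

lemma rotation_apply (i : Fin 3) (θ : ℝ) (x : E3) (j : Fin 3) :
    rotation i θ x j =
      if j = i + 1 then Real.cos θ * x (i + 1) - Real.sin θ * x (i + 2)
      else if j = i + 2 then Real.sin θ * x (i + 1) + Real.cos θ * x (i + 2) else x j := rfl

/-- The action of a linear isometry on the unit sphere. -/
def sphereMap (A : E3 ≃ₗᵢ[ℝ] E3) (x : S2) : S2 := ⟨A x, by simp⟩

@[simp] lemma coe_sphereMap (A : E3 ≃ₗᵢ[ℝ] E3) (x : S2) : (sphereMap A x : E3) = A x := rfl

lemma continuous_sphereMap (A : E3 ≃ₗᵢ[ℝ] E3) : Continuous (sphereMap A) :=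
  (A.continuous.comp continuous_subtype_val).subtype_mk _

instance : IsFiniteMeasure surfaceMeasure := by unfold surfaceMeasure; infer_instance

-- Up to the dimension factor, the surface measure of `s` is the volume of the cone `(0,1) • s`, and
-- a linear isometry carries cones to cones and preserves volume.
open scoped Pointwise in
lemma measurePreserving_sphereMap (A : E3 ≃ₗᵢ[ℝ] E3) :
    MeasurePreserving (sphereMap A) surfaceMeasure surfaceMeasure := by
  refine ⟨(continuous_sphereMap A).measurable, Measure.ext fun s hs => ?_⟩
  have hm := (continuous_sphereMap A).measurable
  rw [Measure.map_apply hm hs, surfaceMeasure, Measure.toSphere_apply' _ hs,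
    Measure.toSphere_apply' _ (hm hs)]
  congr 1
  rw [← A.measurePreserving.measure_preimage_equiv (f := A.toMeasurableEquiv)
    (Ioo (0 : ℝ) 1 • (Subtype.val '' s))]
  congr 1
  ext v
  simp only [Set.mem_smul, Set.mem_preimage, Set.mem_image]
  constructor
  · rintro ⟨r, hr, w, ⟨y, hy, rfl⟩, rfl⟩
    exact ⟨r, hr, A y, ⟨sphereMap A y, hy, rfl⟩, (A.map_smul r y).symm⟩
  · rintro ⟨r, hr, w, ⟨y, hy, rfl⟩, h⟩
    refine ⟨r, hr, A.symm y, ⟨sphereMap A.symm y, ?_, rfl⟩, ?_⟩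
    · have : sphereMap A (sphereMap A.symm y) = y := by ext1; simp
      simpa [this] using hy
    · apply A.injective
      rw [A.map_smul, A.apply_symm_apply]
      exact h

lemma surfaceMeasure_real_univ : surfaceMeasure.real univ = 4 * Real.pi := by
  rw [surfaceMeasure, Measure.toSphere_real_apply_univ, Measure.real,
    EuclideanSpace.volume_ball_fin_three]
  simp only [finrank_euclideanSpace_fin]
  rw [ENNReal.toReal_mul, ENNReal.toReal_ofReal (by positivity)]
  simp
  ring

lemma integrable_of_continuous {F : Type*} [NormedAddCommGroup F] {f : S2 → F}
    (hf : Continuous f) : Integrable f surfaceMeasure :=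
  hf.integrable_of_hasCompactSupport (HasCompactSupport.of_compactSpace f)

/-- The integral of a polynomial over the unit sphere. -/
def sphereIntegral (p : Poly) : ℝ := ∫ x : S2, peval p x ∂surfaceMeasure

lemma continuous_peval_coe (p : Poly) : Continuous fun x : S2 => peval p x :=
  (continuous_peval p).comp continuous_subtype_val

lemma sphereIntegral_add (p q : Poly) :
    sphereIntegral (p + q) = sphereIntegral p + sphereIntegral q := by
  simp only [sphereIntegral, peval_add]
  exact integral_add (integrable_of_continuous (continuous_peval_coe p))
    (integrable_of_continuous (continuous_peval_coe q))

lemma sphereIntegral_smul (c : ℝ) (p : Poly) :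
    sphereIntegral (c • p) = c * sphereIntegral p := by
  simp only [sphereIntegral, peval_smul]
  exact integral_const_mul _ _

/-- The integral over the unit sphere as a linear functional on polynomials. -/
def sphereFunctional : Poly →ₗ[ℝ] ℝ where
  toFun := sphereIntegral
  map_add' := sphereIntegral_add
  map_smul' := sphereIntegral_smul

lemma sphereFunctional_apply (p : Poly) :
    sphereFunctional p = ∫ x : S2, peval p x ∂surfaceMeasure := rfl

/-- The derivation `angular i` generates the rotations about the `i`-th axis; this links the algebra
of polynomials to the invariance of the measure. -/
lemma hasDerivAt_rotation (i : Fin 3) (x : E3) (q : Poly) (θ : ℝ) :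
    HasDerivAt (fun θ => peval q (rotation i θ x)) (peval (angular i q) (rotation i θ x)) θ := by
  have h1 : HasDerivAt (fun θ => rotation i θ x) (WithLp.toLp 2 fun j =>
    if j = i + 1 then - rotation i θ x (i + 2)
    else if j = i + 2 then rotation i θ x (i + 1) else 0) θ := by
    refine (PiLp.continuousLinearEquiv 2 ℝ fun _ : Fin 3 => ℝ).symm.hasFDerivAt.comp_hasDerivAt θ
      (hasDerivAt_pi.2 fun j => ?_)
    have hs := Real.hasDerivAt_sin θ
    have hc := Real.hasDerivAt_cos θ
    fin_cases i <;> fin_cases j <;> simp [rotation_apply]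
    all_goals first
      | exact hasDerivAt_const _ _
      | exact ((hc.mul_const _).sub (hs.mul_const _)).congr_deriv (by ring)
      | exact ((hs.mul_const _).add (hc.mul_const _)).congr_deriv (by ring)
  have h2 := (hasFDerivAt_peval q (rotation i θ x)).comp_hasDerivAt θ h1
  refine h2.congr_deriv ?_
  rw [angular_apply]
  fin_cases i <;> simp [Fin.sum_univ_three] <;> ring

/-- Integration by parts on the sphere: angular derivatives have mean zero. -/
lemma sphereFunctional_angular (i : Fin 3) (q : Poly) : sphereFunctional (angular i q) = 0 := by
  rw [sphereFunctional_apply]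
  have hcont : Continuous fun z : ℝ × S2 => peval (angular i q) (rotation i z.1 z.2) := by
    refine (continuous_peval _).comp ((PiLp.continuous_toLp 2 _).comp (continuous_pi fun j => ?_))
    split_ifs <;> fun_prop
  -- The integral over `θ` and `x` is computed in both orders: along each closed orbit the
  -- derivative integrates to zero, while by invariance the integral over `x` does not depend on
  -- `θ`.
  have h1 (x : S2) : ∫ θ in (0 : ℝ)..(2 * Real.pi), peval (angular i q) (rotation i θ x) = 0 := by
    rw [intervalIntegral.integral_eq_sub_of_hasDerivAt (fun θ _ => hasDerivAt_rotation i x q θ)]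
    · have : rotation i (2 * Real.pi) (x : E3) = rotation i 0 x := by
        ext j; simp [rotation_apply]
      rw [this, sub_self]
    · exact (hcont.comp (continuous_id.prodMk continuous_const)).intervalIntegrable _ _
  have h2 (θ : ℝ) : ∫ x : S2, peval (angular i q) (rotation i θ x) ∂surfaceMeasure =
      ∫ x : S2, peval (angular i q) x ∂surfaceMeasure := by
    have h := measurePreserving_sphereMap (rotation i θ)
    conv_rhs => rw [← h.map_eq]
    rw [integral_map h.measurable.aemeasurable
      (continuous_peval_coe _).aestronglyMeasurable]
    rfl
  have h3 : ∫ θ in (0 : ℝ)..(2 * Real.pi), ∫ x : S2, peval (angular i q) (rotation i θ x)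
      ∂surfaceMeasure = 0 := by
    rw [intervalIntegral_integral_swap]
    · simp [h1]
    · rw [← Measure.restrict_univ (μ := surfaceMeasure), Measure.prod_restrict]
      refine (hcont.continuousOn.integrableOn_compact
        (isCompact_uIcc.prod isCompact_univ)).mono_set (prod_mono uIoc_subset_uIcc subset_rfl)
  simp only [h2, intervalIntegral.integral_const, smul_eq_mul] at h3
  have := Real.pi_pos
  simpa using h3

/-! ### Solid harmonics and the angular Laplacian. -/

open MvPolynomial in
lemma pderiv_comm (i j : Fin 3) (p : Poly) : pderiv i (pderiv j p) = pderiv j (pderiv i p) := by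
  have h : ⁅(pderiv i : Derivation ℝ Poly Poly),
      (pderiv j : Derivation ℝ Poly Poly)⁆ = 0 := by
    ext k
    simp [Derivation.commutator_apply, pderiv_X, Pi.single_apply,
      apply_ite (pderiv (R := ℝ) (σ := Fin 3) _)]
  have := congrArg (fun D : Derivation ℝ Poly Poly => D p) h
  simpa [Derivation.commutator_apply, sub_eq_zero] using this

/-- The Laplacian on polynomials. -/
def laplacian (p : Poly) : Poly := ∑ i, MvPolynomial.pderiv i (MvPolynomial.pderiv i p)

/-- Harmonic homogeneous polynomials of degree `ℓ`. -/
structure IsSolidHarmonic (ℓ : ℕ) (p : Poly) : Prop where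
  isHomogeneous : p.IsHomogeneous ℓ
  laplacian_eq_zero : laplacian p = 0

open MvPolynomial in
lemma laplacian_pderiv (i : Fin 3) (p : Poly) :
    laplacian (pderiv i p) = pderiv i (laplacian p) := by
  simp only [laplacian, map_sum]
  refine Finset.sum_congr rfl fun j _ => ?_
  rw [pderiv_comm j i p, pderiv_comm j i]

open MvPolynomial in
lemma IsSolidHarmonic.pderiv {ℓ : ℕ} {p : Poly} (hp : IsSolidHarmonic ℓ p) (i : Fin 3) :
    IsSolidHarmonic (ℓ - 1) (MvPolynomial.pderiv i p) :=
  ⟨hp.isHomogeneous.pderiv, by rw [laplacian_pderiv, hp.laplacian_eq_zero, map_zero]⟩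

-- The Laplacian commutes with infinitesimal rotations. Hence the components of `x × ∇ p` are again
-- solid harmonics of the same degree, to which Funk–Hecke applies.
open MvPolynomial in
lemma laplacian_angular (i : Fin 3) (p : Poly) :
    laplacian (angular i p) = angular i (laplacian p) := by
  fin_cases i <;>
  simp only [laplacian, angular_apply, Fin.sum_univ_three, map_add, map_sub, Derivation.leibniz,
    pderiv_X, smul_eq_mul, Fin.isValue, Fin.reduceAdd, Fin.zero_eta, Fin.mk_one, Fin.reduceFinMk,
    zero_add, Pi.single_apply, Fin.reduceEq, if_true, if_false, Derivation.map_one_eq_zero, map_zero,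
    mul_zero, add_zero, mul_one, pderiv_comm 1 0, pderiv_comm 2 0, pderiv_comm 2 1] <;> ring

open MvPolynomial in
lemma _root_.MvPolynomial.IsHomogeneous.mul_pderiv {ℓ d : ℕ} {p q : Poly} (hp : p.IsHomogeneous ℓ)
    (hq : q.IsHomogeneous (d + 1)) (j : Fin 3) : (q * pderiv j p).IsHomogeneous (ℓ + d) := by
  -- In degree `0` the truncated `ℓ - 1` would give the wrong degree, but then the derivative
  -- vanishes and is homogeneous of every degree.
  rcases Nat.eq_zero_or_pos ℓ with rfl | h
  · rw [← totalDegree_zero_iff_isHomogeneous, totalDegree_eq_zero_iff_eq_C] at hp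
    rw [hp]
    simp [isHomogeneous_zero]
  · have := hq.mul (hp.pderiv (i := j))
    rwa [show d + 1 + (ℓ - 1) = ℓ + d by omega] at this

open MvPolynomial in
lemma IsSolidHarmonic.angular {ℓ : ℕ} {p : Poly} (hp : IsSolidHarmonic ℓ p) (i : Fin 3) :
    IsSolidHarmonic ℓ (angular i p) := by
  refine ⟨?_, by rw [laplacian_angular, hp.laplacian_eq_zero, map_zero]⟩
  rw [angular_apply]
  exact (hp.isHomogeneous.mul_pderiv (d := 0) (isHomogeneous_X _ _) _).sub
    (hp.isHomogeneous.mul_pderiv (d := 0) (isHomogeneous_X _ _) _)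

open MvPolynomial in
lemma sum_X_mul_pderiv {ℓ : ℕ} {p : Poly} (hp : p.IsHomogeneous ℓ) :
    X 0 * pderiv 0 p + X 1 * pderiv 1 p + X 2 * pderiv 2 p = C (ℓ : ℝ) * p := by
  have := hp.sum_X_mul_pderiv
  simpa [Fin.sum_univ_three] using this

open MvPolynomial in
/-- The angular part of the Laplacian acts on solid harmonics by an eigenvalue. -/
lemma sum_angular_angular {ℓ : ℕ} {p : Poly} (hp : IsSolidHarmonic ℓ p) :
    ∑ i, angular i (angular i p) = C (-eigenvalue ℓ) * p := by
  have hE := sum_X_mul_pderiv hp.isHomogeneous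
  have hD := hp.laplacian_eq_zero
  have h0 := congrArg (MvPolynomial.pderiv 0) hE
  have h1 := congrArg (MvPolynomial.pderiv 1) hE
  have h2 := congrArg (MvPolynomial.pderiv 2) hE
  simp only [laplacian, angular_apply, Fin.sum_univ_three, map_add, map_sub, Derivation.leibniz,
    pderiv_X, smul_eq_mul, Fin.isValue, Fin.reduceAdd, zero_add, Pi.single_apply, pderiv_C,
    Fin.reduceEq, if_true, if_false, mul_zero, add_zero, mul_one,
    pderiv_comm 1 0, pderiv_comm 2 0, pderiv_comm 2 1] at hD h0 h1 h2 ⊢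
  simp only [eigenvalue, C_neg, C_mul, C_add, map_natCast, C_1] at hE h0 h1 h2 ⊢
  -- With `E` the Euler operator, `∑ A_i² = |x|² Δ - E² - E`; the differentiated Euler relations
  -- account for `E²`.
  linear_combination (X 0 ^ 2 + X 1 ^ 2 + X 2 ^ 2) * hD - X 0 * h0 - X 1 * h1 - X 2 * h2 -
    ((ℓ : Poly) + 1) * hE

open MvPolynomial in
/-- The harmonic part of `x_i p`. -/
lemma isSolidHarmonic_X_mul_sub {ℓ : ℕ} {p : Poly} (hp : IsSolidHarmonic ℓ p) (i : Fin 3) :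
    IsSolidHarmonic (ℓ + 1)
      (X i * p - C ((2 * ℓ + 1 : ℝ)⁻¹) * ((X 0 ^ 2 + X 1 ^ 2 + X 2 ^ 2) * pderiv i p)) := by
  refine ⟨?_, ?_⟩
  · refine IsHomogeneous.sub ?_ (IsHomogeneous.C_mul (hp.isHomogeneous.mul_pderiv (d := 1) ?_ i) _)
    · rw [add_comm]
      exact (isHomogeneous_X _ _).mul hp.isHomogeneous
    · exact ((isHomogeneous_X_pow _ _).add (isHomogeneous_X_pow _ _)).add (isHomogeneous_X_pow _ _)
  · have hE := congrArg (MvPolynomial.pderiv i) (sum_X_mul_pderiv hp.isHomogeneous)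
    have hD := (hp.pderiv i).laplacian_eq_zero
    have hD' := hp.laplacian_eq_zero
    -- The constant comes from `Δ(x_i p) = 2 ∂_i p` and `Δ(|x|² ∂_i p) = (4ℓ + 2) ∂_i p`.
    have hc : (C ((2 * ℓ + 1 : ℝ)⁻¹) : Poly) * (2 * C (ℓ : ℝ) + 1) = 1 := by
      have : (2 * ℓ + 1 : ℝ) ≠ 0 := by positivity
      rw [← C_1, ← map_ofNat C 2, ← C_mul, ← C_add, ← C_mul, inv_mul_cancel₀ this]
    fin_cases i <;>
    simp only [laplacian, Fin.sum_univ_three, map_add, map_sub, Derivation.leibniz, pderiv_X,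
      smul_eq_mul, Fin.isValue, Fin.zero_eta, Fin.mk_one, Fin.reduceFinMk, zero_add,
      Pi.single_apply, pderiv_C, Fin.reduceEq, if_true, if_false, Derivation.map_one_eq_zero,
      map_zero, mul_zero, zero_mul, add_zero, mul_one, pow_two,
      pderiv_comm 1 0, pderiv_comm 2 0, pderiv_comm 2 1] at hD hD' hE ⊢ <;>
    generalize (C ((2 * ℓ + 1 : ℝ)⁻¹) : Poly) = c at hc ⊢
    · linear_combination X 0 * hD' - c * (X 0 ^ 2 + X 1 ^ 2 + X 2 ^ 2) * hD - 4 * c * hE -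
        2 * pderiv 0 p * hc
    · linear_combination X 1 * hD' - c * (X 0 ^ 2 + X 1 ^ 2 + X 2 ^ 2) * hD - 4 * c * hE -
        2 * pderiv 1 p * hc
    · linear_combination X 2 * hD' - c * (X 0 ^ 2 + X 1 ^ 2 + X 2 ^ 2) * hD - 4 * c * hE -
        2 * pderiv 2 p * hc

/-! ### Legendre polynomials -/
-- Bonnet's recursion before normalization. Moving one factor `X` through the iterated derivative,
-- or differentiating twice first, gives two formulas for the left side; the combination used
-- eliminates the `n`-th derivative of `(X² - 1)^(n+1)`.
open Polynomial in
lemma iterate_derivative_succ_sq_sub_one_pow (n : ℕ) :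
    derivative^[n + 2] ((X ^ 2 - 1 : ℝ[X]) ^ (n + 2)) =
      C (2 * (2 * (n + 1) + 1) : ℝ) * (X * derivative^[n + 1] ((X ^ 2 - 1 : ℝ[X]) ^ (n + 1))) -
        C (4 * (n + 1) ^ 2 : ℝ) * derivative^[n] ((X ^ 2 - 1 : ℝ[X]) ^ n) := by
  have hd (k : ℕ) : derivative ((X ^ 2 - 1 : ℝ[X]) ^ (k + 1)) =
      C (2 * (k + 1) : ℝ) * ((X ^ 2 - 1) ^ k * X) := by
    simp [derivative_pow]
    ring
  have h1 : derivative^[n + 2] ((X ^ 2 - 1 : ℝ[X]) ^ (n + 2)) =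
      C (2 * (n + 2) : ℝ) * (X * derivative^[n + 1] ((X ^ 2 - 1 : ℝ[X]) ^ (n + 1)) +
        C (n + 1 : ℝ) * derivative^[n] ((X ^ 2 - 1 : ℝ[X]) ^ (n + 1))) := by
    rw [Function.iterate_succ_apply, hd, iterate_derivative_C_mul, iterate_derivative_mul_X]
    simp only [Nat.add_sub_cancel, nsmul_eq_mul, Nat.cast_add, Nat.cast_one, C_mul, C_add, C_1,
      map_natCast, map_ofNat]
    ring
  have h2 : derivative^[n + 2] ((X ^ 2 - 1 : ℝ[X]) ^ (n + 2)) =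
      C (2 * (n + 2) : ℝ) *
        (C (2 * (n + 1) + 1 : ℝ) * derivative^[n] ((X ^ 2 - 1 : ℝ[X]) ^ (n + 1)) +
        C (2 * (n + 1) : ℝ) * derivative^[n] ((X ^ 2 - 1 : ℝ[X]) ^ n)) := by
    rw [Function.iterate_succ_apply, Function.iterate_succ_apply, hd, derivative_C_mul,
      derivative_mul, hd, ← iterate_derivative_C_mul, ← iterate_derivative_C_mul,
      ← iterate_map_add, ← iterate_derivative_C_mul]
    congr 1
    simp only [derivative_X, Nat.cast_add, Nat.cast_one, C_mul, C_add, C_1, map_natCast, map_ofNat]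
    ring
  have h3 : C (n + 2 : ℝ) * derivative^[n + 2] ((X ^ 2 - 1 : ℝ[X]) ^ (n + 2)) = C (n + 2 : ℝ) * (
      C (2 * (2 * (n + 1) + 1) : ℝ) * (X * derivative^[n + 1] ((X ^ 2 - 1 : ℝ[X]) ^ (n + 1))) -
        C (4 * (n + 1) ^ 2 : ℝ) * derivative^[n] ((X ^ 2 - 1 : ℝ[X]) ^ n)) := by
    simp only [C_mul, C_add, C_pow, map_ofNat, map_natCast, C_1] at h1 h2 ⊢
    linear_combination (2 * (n + 1) + 1 : ℝ[X]) * h1 - (n + 1 : ℝ[X]) * h2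
  have : (C (n + 2 : ℝ) : ℝ[X]) ≠ 0 := by
    rw [Ne, C_eq_zero]; positivity
  exact mul_left_cancel₀ this h3

open Polynomial in
/-- Bonnet's recursion. -/
lemma X_mul_legendre (ℓ : ℕ) :
    C (2 * ℓ + 1 : ℝ) * (X * legendre ℓ) =
      C (ℓ + 1 : ℝ) * legendre (ℓ + 1) + C (ℓ : ℝ) * legendre (ℓ - 1) := by
  rcases ℓ with _ | n
  · refine Polynomial.funext fun t => ?_
    simp [legendre]
    ring
  · have h := iterate_derivative_succ_sq_sub_one_pow n
    simp only [legendre, h, Nat.add_sub_cancel]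
    have hf : (n.factorial : ℝ) ≠ 0 := by positivity
    refine Polynomial.funext fun t => ?_
    simp only [eval_mul, eval_add, eval_sub, eval_C, eval_X]
    push_cast [Nat.factorial_succ]
    field_simp
    ring

open Polynomial in
lemma integral_legendre (ℓ : ℕ) :
    ∫ t in (-1 : ℝ)..1, (legendre ℓ).eval t = if ℓ = 0 then 2 else 0 := by
  rcases ℓ with _ | k
  · norm_num [legendre]
  · have hdvd : (X ^ 2 - 1 : ℝ[X]) ∣ derivative^[k] ((X ^ 2 - 1 : ℝ[X]) ^ (k + 1)) := by
      simpa using pow_sub_dvd_iterate_derivative_of_pow_dvd k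
        (dvd_refl ((X ^ 2 - 1 : ℝ[X]) ^ (k + 1)))
    obtain ⟨q, hq⟩ := hdvd
    simp only [legendre, eval_mul, eval_C, intervalIntegral.integral_const_mul,
      Function.iterate_succ_apply', hq]
    rw [intervalIntegral.integral_eq_sub_of_hasDerivAt (fun t _ => Polynomial.hasDerivAt _ t)
      ((Polynomial.continuous _).intervalIntegrable _ _)]
    simp

-- The recursion for moments that the sphere integrals in Funk–Hecke will have to match. For `ℓ = 0`
-- the truncated index `ℓ - 1` is harmless because of its factor `ℓ`.
open Polynomial in
lemma integral_pow_succ_mul_legendre (n ℓ : ℕ) :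
    (2 * ℓ + 1 : ℝ) * ∫ t in (-1 : ℝ)..1, t ^ (n + 1) * (legendre ℓ).eval t =
      (ℓ + 1 : ℝ) * (∫ t in (-1 : ℝ)..1, t ^ n * (legendre (ℓ + 1)).eval t) +
        (ℓ : ℝ) * ∫ t in (-1 : ℝ)..1, t ^ n * (legendre (ℓ - 1)).eval t := by
  rw [← intervalIntegral.integral_const_mul, ← intervalIntegral.integral_const_mul,
    ← intervalIntegral.integral_const_mul, ← intervalIntegral.integral_add]
  · refine intervalIntegral.integral_congr fun t _ => ?_
    have := congrArg (eval t) (X_mul_legendre ℓ)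
    simp only [eval_mul, eval_C, eval_X, eval_add] at this
    linear_combination t ^ n * this
  all_goals
    exact Continuous.intervalIntegrable (by fun_prop) _ _

/-! ### The Funk–Hecke formula -/

lemma sphereFunctional_C (c : ℝ) : sphereFunctional (MvPolynomial.C c) = 4 * Real.pi * c := by
  simp [sphereFunctional_apply, surfaceMeasure_real_univ]

lemma sphereFunctional_congr {p q : Poly} (h : ∀ x : S2, peval p x = peval q x) :
    sphereFunctional p = sphereFunctional q := by
  simp only [sphereFunctional_apply, h]

lemma sum_sq_coe (x : S2) : (x : E3) 0 ^ 2 + (x : E3) 1 ^ 2 + (x : E3) 2 ^ 2 = 1 := by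
  have h : ‖(x : E3)‖ ^ 2 = 1 := by simp
  rw [EuclideanSpace.real_norm_sq_eq, Fin.sum_univ_three] at h
  exact h

/-- Solid harmonics of positive degree have mean zero on the sphere. -/
lemma sphereFunctional_eq_zero_of_isSolidHarmonic {ℓ : ℕ} {p : Poly} (hp : IsSolidHarmonic ℓ p)
    (hℓ : ℓ ≠ 0) : sphereFunctional p = 0 := by
  have h := congrArg sphereFunctional (sum_angular_angular hp)
  rw [map_sum, Finset.sum_eq_zero fun i _ => sphereFunctional_angular i _,
    ← MvPolynomial.smul_eq_C_mul, map_smul, smul_eq_mul, eq_comm, mul_eq_zero] at h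
  refine h.resolve_left (neg_ne_zero.2 ?_)
  have : (0 : ℝ) < ℓ := by exact_mod_cast Nat.pos_of_ne_zero hℓ
  unfold eigenvalue
  positivity

/-- The linear form `y ↦ e · y` as a polynomial. -/
def linearForm (e : E3) : Poly := ∑ i, MvPolynomial.C (e i) * MvPolynomial.X i

@[simp] lemma peval_linearForm (e x : E3) : peval (linearForm e) x = inner ℝ e x := by
  simp [linearForm, PiLp.inner_apply, mul_comm]

/-- Induction on `n`, for all degrees at once: on the sphere `x_i p` is a solid harmonic of degree
`ℓ + 1` plus a multiple of `∂_i p`, so a factor `e · x` is traded for degrees `ℓ ± 1`. Evaluating at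
`e` with Euler's relation gives exactly Bonnet's recursion. -/
lemma sphereFunctional_linearForm_pow_mul (n : ℕ) {ℓ : ℕ} {p : Poly} (hp : IsSolidHarmonic ℓ p)
    (e : S2) :
    sphereFunctional (linearForm e ^ n * p) =
      2 * Real.pi * (∫ t in (-1 : ℝ)..1, t ^ n * (legendre ℓ).eval t) * peval p e := by
  induction n generalizing ℓ p with
  | zero =>
    simp only [pow_zero, one_mul, integral_legendre]
    split_ifs with h
    · subst h
      have h0 := hp.isHomogeneous
      rw [← MvPolynomial.totalDegree_zero_iff_isHomogeneous,
        MvPolynomial.totalDegree_eq_zero_iff_eq_C] at h0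
      rw [h0, sphereFunctional_C, peval_C]
      ring
    · rw [sphereFunctional_eq_zero_of_isSolidHarmonic hp h]
      ring
  | succ n ih =>
    have hc : (2 * ℓ + 1 : ℝ) ≠ 0 := by positivity
    set c : ℝ := (2 * ℓ + 1 : ℝ)⁻¹ with hcdef
    obtain ⟨h, hh, hhe⟩ : ∃ h : Fin 3 → Poly, (∀ i, IsSolidHarmonic (ℓ + 1) (h i)) ∧
        ∀ i (x : S2), peval (h i) x =
          (x : E3) i * peval p x - c * peval (MvPolynomial.pderiv i p) x :=
      ⟨_, isSolidHarmonic_X_mul_sub hp, fun i x => by simp [hcdef, sum_sq_coe x]⟩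
    have key : sphereFunctional (linearForm e ^ (n + 1) * p) =
        sphereFunctional (∑ i, (e : E3) i • (linearForm e ^ n * h i +
          c • (linearForm e ^ n * MvPolynomial.pderiv i p))) := by
      refine sphereFunctional_congr fun x => ?_
      simp only [peval_smul, peval_add, peval_mul, peval_pow, hhe, pow_succ,
        peval_linearForm, PiLp.inner_apply, Fin.sum_univ_three, RCLike.inner_apply, conj_trivial]
      ring
    have hE : ∑ i, (e : E3) i * peval (MvPolynomial.pderiv i p) e = ℓ * peval p e := by
      have := congrArg (fun q => peval q e) (sum_X_mul_pderiv hp.isHomogeneous)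
      simpa [Fin.sum_univ_three, -map_natCast] using this
    rw [key, map_sum]
    simp only [map_smul, map_add, smul_eq_mul, ih (hh _), ih (hp.pderiv _), hhe]
    have hr := integral_pow_succ_mul_legendre n ℓ
    generalize (∫ t in (-1 : ℝ)..1, t ^ n * (legendre (ℓ + 1)).eval t) = A at hr ⊢
    generalize (∫ t in (-1 : ℝ)..1, t ^ n * (legendre (ℓ - 1)).eval t) = B at hr ⊢
    generalize (∫ t in (-1 : ℝ)..1, t ^ (n + 1) * (legendre ℓ).eval t) = D at hr ⊢
    have hD : D = c * ((ℓ + 1) * A + ℓ * B) := by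
      rw [← hr, hcdef, inv_mul_cancel_left₀ hc]
    have hc1 : c * (2 * ℓ + 1) = 1 := inv_mul_cancel₀ hc
    have hx := sum_sq_coe e
    simp only [Fin.sum_univ_three] at hE ⊢
    rw [hD]
    linear_combination 2 * Real.pi * A * peval p e * hx + (c * 2 * Real.pi * (B - A)) * hE -
      2 * Real.pi * A * peval p e * hc1

/-- The Funk–Hecke formula for polynomial zonal functions. -/
lemma sphereFunctional_aeval_linearForm_mul (g : Polynomial ℝ) {ℓ : ℕ} {p : Poly}
    (hp : IsSolidHarmonic ℓ p) (e : S2) :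
    sphereFunctional (Polynomial.aeval (linearForm e) g * p) = zonalCoeff g.eval ℓ * peval p e := by
  unfold zonalCoeff
  induction g using Polynomial.induction_on' with
  | add f g hf hg =>
    have : ∫ t in (-1 : ℝ)..1, (f + g).eval t * (legendre ℓ).eval t =
      (∫ t in (-1 : ℝ)..1, f.eval t * (legendre ℓ).eval t) +
        ∫ t in (-1 : ℝ)..1, g.eval t * (legendre ℓ).eval t := by
      simp only [Polynomial.eval_add, add_mul]
      exact intervalIntegral.integral_add (Continuous.intervalIntegrable (by fun_prop) _ _)
        (Continuous.intervalIntegrable (by fun_prop) _ _)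
    rw [map_add, add_mul, map_add, hf, hg, this]
    ring
  | monomial n a =>
    rw [← Polynomial.C_mul_X_pow_eq_monomial, map_mul (Polynomial.aeval (linearForm e)),
      Polynomial.aeval_C, map_pow, Polynomial.aeval_X, mul_assoc, ← Algebra.smul_def, map_smul,
      sphereFunctional_linearForm_pow_mul n hp]
    simp only [Polynomial.eval_mul, Polynomial.eval_C, Polynomial.eval_pow, Polynomial.eval_X,
      mul_assoc, intervalIntegral.integral_const_mul, smul_eq_mul]
    ring

lemma inner_mem_Icc (x y : S2) : inner ℝ (x : E3) y ∈ Icc (-1 : ℝ) 1 := by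
  have := abs_real_inner_le_norm (x : E3) y
  simp only [norm_eq_of_mem_sphere, mul_one] at this
  exact abs_le.1 this

/-- Weierstrass approximation, followed by a constant shift that corrects the mean. The integral
must agree exactly, because otherwise `κ` of the approximant would be singular at `1`. -/
lemma exists_polynomial_forall_abs_sub_le {ψ : ℝ → ℝ} (hψ : Continuous ψ) {ε : ℝ} (hε : 0 < ε) :
    ∃ q : Polynomial ℝ, (∀ t ∈ Icc (-1 : ℝ) 1, |ψ t - q.eval t| ≤ ε) ∧
      ∫ t in (-1 : ℝ)..1, q.eval t = ∫ t in (-1 : ℝ)..1, ψ t := by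
  obtain ⟨q, hq⟩ := exists_polynomial_near_of_continuousOn (-1) 1 ψ hψ.continuousOn (ε / 2)
    (by positivity)
  set c : ℝ := (∫ t in (-1 : ℝ)..1, ψ t - q.eval t) / 2 with hc
  have hcε : |c| ≤ ε / 2 := by
    have := intervalIntegral.norm_integral_le_of_norm_le_const (a := -1) (b := 1) (C := ε / 2)
      (f := fun t => ψ t - q.eval t) fun t ht => by
        rw [uIoc_of_le (by norm_num)] at ht
        rw [Real.norm_eq_abs, abs_sub_comm]
        exact (hq t ⟨ht.1.le, ht.2⟩).le
    rw [hc, abs_div, abs_two]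
    rw [Real.norm_eq_abs] at this
    norm_num at this ⊢
    linarith
  refine ⟨q + Polynomial.C c, fun t ht => ?_, ?_⟩
  · have h1 := hq t ht
    rw [abs_sub_comm] at h1
    calc |ψ t - (q + Polynomial.C c).eval t| = |(ψ t - q.eval t) - c| := by simp; ring_nf
      _ ≤ |ψ t - q.eval t| + |c| := abs_sub _ _
      _ ≤ ε := by linarith
  · simp only [Polynomial.eval_add, Polynomial.eval_C]
    rw [intervalIntegral.integral_sub (hψ.intervalIntegrable _ _)
      (q.continuous.intervalIntegrable _ _)] at hc
    rw [intervalIntegral.integral_add (q.continuous.intervalIntegrable _ _)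
      intervalIntegrable_const, intervalIntegral.integral_const, hc]
    simp
    ring

@[simp] lemma peval_aeval (P : Poly) (q : Polynomial ℝ) (x : E3) :
    peval (Polynomial.aeval P q) x = q.eval (peval P x) := by
  induction q using Polynomial.induction_on' with
  | add f g hf hg => simp [hf, hg]
  | monomial n a =>
    rw [← Polynomial.C_mul_X_pow_eq_monomial]
    simp [MvPolynomial.algebraMap_eq]

lemma integral_polynomial_inner (q : Polynomial ℝ) (e : S2) :
    ∫ x : S2, q.eval (inner ℝ (x : E3) e) ∂surfaceMeasure =
      2 * Real.pi * ∫ t in (-1 : ℝ)..1, q.eval t := by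
  have h1 : IsSolidHarmonic 0 1 := ⟨MvPolynomial.isHomogeneous_one _ _, by simp [laplacian]⟩
  have h := sphereFunctional_aeval_linearForm_mul q h1 e
  have h2 (x : S2) : peval (Polynomial.aeval (linearForm e) q) x = q.eval (inner ℝ (x : E3) e) := by
    rw [peval_aeval, peval_linearForm, real_inner_comm]
  rw [mul_one, sphereFunctional_apply] at h
  simpa [h2, zonalCoeff, legendre] using h

/-- Archimedes' formula. -/
lemma integral_zonal {h : ℝ → ℝ} (hh : Continuous h) (e : S2) :
    ∫ x : S2, h (inner ℝ (x : E3) e) ∂surfaceMeasure = 2 * Real.pi * ∫ t in (-1 : ℝ)..1, h t := by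
  refine eq_of_forall_dist_le fun ε hε => ?_
  have hpi := Real.pi_pos
  obtain ⟨q, hq, hqi⟩ := exists_polynomial_forall_abs_sub_le hh (ε := ε / (4 * Real.pi))
    (by positivity)
  have hcont {g : ℝ → ℝ} (hg : Continuous g) : Continuous fun x : S2 => g (inner ℝ (x : E3) e) := by
    fun_prop
  rw [← hqi, ← integral_polynomial_inner q e, dist_eq_norm, ← integral_sub
    (integrable_of_continuous (hcont hh)) (integrable_of_continuous (hcont q.continuous))]
  refine (norm_integral_le_of_norm_le_const (.of_forall fun x => hq _ (inner_mem_Icc x e))).trans ?_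
  rw [surfaceMeasure_real_univ]
  field_simp
  rfl

/-! ### The auxiliary function `κ` -/

/-- Continuous profiles whose zonal function has integral one. -/
structure IsProfile (ψ : ℝ → ℝ) : Prop where
  continuous : Continuous ψ
  integral_eq : ∫ t in (-1 : ℝ)..1, ψ t = (2 * Real.pi)⁻¹

lemma IsProfile.continuous_defect {ψ : ℝ → ℝ} (hψ : IsProfile ψ) :
    Continuous fun s => 1 - 4 * Real.pi * ψ s := by
  have := hψ.continuous
  fun_prop

lemma IsProfile.integral_defect {ψ : ℝ → ℝ} (hψ : IsProfile ψ) :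
    ∫ s in (-1 : ℝ)..1, (1 - 4 * Real.pi * ψ s) = 0 := by
  rw [intervalIntegral.integral_sub intervalIntegrable_const
    ((hψ.continuous.const_mul _).intervalIntegrable _ _), intervalIntegral.integral_const_mul,
    hψ.integral_eq]
  have := Real.pi_ne_zero
  simp
  field_simp
  ring

/-- The formula defining `κ` on the open interval. -/
def kappaAux (ψ : ℝ → ℝ) (t : ℝ) : ℝ :=
  (∫ s in (-1 : ℝ)..t, (1 - 4 * Real.pi * ψ s)) / (4 * Real.pi * (1 - t ^ 2))

lemma one_sub_sq_pos {t : ℝ} (ht : t ∈ Ioo (-1 : ℝ) 1) : 0 < 1 - t ^ 2 := by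
  nlinarith [ht.1, ht.2]

lemma IsProfile.hasDerivAt_integral_defect {ψ : ℝ → ℝ} (hψ : IsProfile ψ) (t : ℝ) :
    HasDerivAt (fun t => ∫ s in (-1 : ℝ)..t, (1 - 4 * Real.pi * ψ s)) (1 - 4 * Real.pi * ψ t) t :=
  hψ.continuous_defect.integral_hasStrictDerivAt (-1) t |>.hasDerivAt

lemma IsProfile.hasDerivAt_kappaAux {ψ : ℝ → ℝ} (hψ : IsProfile ψ) {t : ℝ}
    (ht : t ∈ Ioo (-1 : ℝ) 1) :
    HasDerivAt (kappaAux ψ)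
      ((2 * t * kappaAux ψ t + ((4 * Real.pi)⁻¹ - ψ t)) / (1 - t ^ 2)) t := by
  have hpi := Real.pi_ne_zero
  have ht' := (one_sub_sq_pos ht).ne'
  have h1 : HasDerivAt (fun t : ℝ => 4 * Real.pi * (1 - t ^ 2)) (4 * Real.pi * (-(2 * t))) t := by
    simpa using ((hasDerivAt_pow 2 t).const_sub 1).const_mul (4 * Real.pi)
  refine ((hψ.hasDerivAt_integral_defect t).div h1 (by positivity)).congr_deriv ?_
  unfold kappaAux
  field_simp
  ring

/-- The normalization makes the numerator vanish at `1`, so the quotient is a difference quotient of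
it times a factor continuous at `1`. -/
lemma IsProfile.tendsto_kappaAux_one {ψ : ℝ → ℝ} (hψ : IsProfile ψ) :
    ∃ a, Filter.Tendsto (kappaAux ψ) (nhdsWithin 1 (Iio 1)) (nhds a) := by
  have h := (hasDerivAt_iff_tendsto_slope.1 (hψ.hasDerivAt_integral_defect 1)).mono_left
    (nhdsWithin_mono 1 fun t (ht : t < 1) => ht.ne)
  have h2 : Filter.Tendsto (fun t : ℝ => -(4 * Real.pi * (1 + t))⁻¹) (nhdsWithin 1 (Iio 1))
      (nhds (-(4 * Real.pi * (1 + 1))⁻¹)) := by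
    refine (ContinuousAt.neg (ContinuousAt.inv₀ (by fun_prop) ?_)).mono_left nhdsWithin_le_nhds
    have := Real.pi_pos
    positivity
  refine ⟨_, (h.mul h2).congr' ?_⟩
  filter_upwards [self_mem_nhdsWithin, Ioo_mem_nhdsLT (show (0 : ℝ) < 1 by norm_num)] with t ht ht0
  rw [slope_def_field, hψ.integral_defect, kappaAux]
  have h3 : t - 1 ≠ 0 := by have := ht0.2; intro h; linarith
  have h4 : 1 + t ≠ 0 := by have := ht0.1; intro h; linarith
  have h5 : 1 - t ^ 2 = -((t - 1) * (1 + t)) := by ring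
  rw [h5]
  have := Real.pi_ne_zero
  field_simp
  ring

lemma IsProfile.tendsto_kappaAux_neg_one {ψ : ℝ → ℝ} (hψ : IsProfile ψ) :
    ∃ a, Filter.Tendsto (kappaAux ψ) (nhdsWithin (-1) (Ioi (-1))) (nhds a) := by
  have h := (hasDerivAt_iff_tendsto_slope.1 (hψ.hasDerivAt_integral_defect (-1))).mono_left
    (nhdsWithin_mono (-1) fun t (ht : -1 < t) => ht.ne')
  have h2 : Filter.Tendsto (fun t : ℝ => (4 * Real.pi * (1 - t))⁻¹) (nhdsWithin (-1) (Ioi (-1)))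
      (nhds ((4 * Real.pi * (1 - (-1)))⁻¹)) := by
    refine (ContinuousAt.inv₀ (by fun_prop) ?_).mono_left nhdsWithin_le_nhds
    have := Real.pi_ne_zero
    norm_num [this]
  refine ⟨_, (h.mul h2).congr' ?_⟩
  filter_upwards [self_mem_nhdsWithin, Ioo_mem_nhdsGT (show (-1 : ℝ) < 0 by norm_num)] with t ht ht0
  rw [slope_def_field, intervalIntegral.integral_same, kappaAux]
  have h3 : t + 1 ≠ 0 := by have := ht0.1; intro h; linarith
  have h4 : 1 - t ≠ 0 := by have := ht0.2; intro h; linarith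
  have h5 : 1 - t ^ 2 = (t + 1) * (1 - t) := by ring
  rw [h5, sub_zero, sub_neg_eq_add]
  have := Real.pi_ne_zero
  field_simp

lemma IsProfile.continuousOn_kappa {ψ : ℝ → ℝ} (hψ : IsProfile ψ) :
    ContinuousOn (kappa ψ) (Icc (-1) 1) := by
  obtain ⟨a, ha⟩ := hψ.tendsto_kappaAux_neg_one
  obtain ⟨b, hb⟩ := hψ.tendsto_kappaAux_one
  exact continuousOn_Icc_extendFrom_Ioo (f := kappaAux ψ)
    (fun t ht => (hψ.hasDerivAt_kappaAux ht).continuousAt.continuousWithinAt) ha hb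

lemma IsProfile.kappa_eq_kappaAux {ψ : ℝ → ℝ} (hψ : IsProfile ψ) {t : ℝ}
    (ht : t ∈ Ioo (-1 : ℝ) 1) : kappa ψ t = kappaAux ψ t :=
  extendFrom_eq (subset_closure ht) (hψ.hasDerivAt_kappaAux ht).continuousAt.continuousWithinAt

lemma IsProfile.deriv_kappa {ψ : ℝ → ℝ} (hψ : IsProfile ψ) {t : ℝ} (ht : t ∈ Ioo (-1 : ℝ) 1) :
    deriv (kappa ψ) t = (2 * t * kappa ψ t + ((4 * Real.pi)⁻¹ - ψ t)) / (1 - t ^ 2) := by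
  rw [hψ.kappa_eq_kappaAux ht]
  refine ((hψ.hasDerivAt_kappaAux ht).congr_of_eventuallyEq ?_).deriv
  filter_upwards [isOpen_Ioo.mem_nhds ht] with s hs using hψ.kappa_eq_kappaAux hs

lemma forall_Icc_of_forall_Ioo {f : ℝ → ℝ} (hf : ContinuousOn f (Icc (-1) 1)) {C : ℝ}
    (h : ∀ t ∈ Ioo (-1 : ℝ) 1, f t ≤ C) : ∀ t ∈ Icc (-1 : ℝ) 1, f t ≤ C := by
  rw [← closure_Ioo (by norm_num)] at hf ⊢
  exact fun t ht => le_on_closure h hf continuousOn_const ht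

/-- The difference of the profiles has total integral zero, so its primitive can be estimated from
either endpoint. This gives `ε * min (1 + t) (1 - t)`, which the denominator `1 - t²` dominates. -/
lemma IsProfile.abs_kappa_sub_le {ψ₁ ψ₂ : ℝ → ℝ} (h₁ : IsProfile ψ₁) (h₂ : IsProfile ψ₂) {ε : ℝ}
    (hε : ∀ t ∈ Icc (-1 : ℝ) 1, |ψ₁ t - ψ₂ t| ≤ ε) :
    ∀ t ∈ Icc (-1 : ℝ) 1, |kappa ψ₁ t - kappa ψ₂ t| ≤ ε := by
  refine forall_Icc_of_forall_Ioo (h₁.continuousOn_kappa.sub h₂.continuousOn_kappa).abs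
    fun t ht => ?_
  have hpi := Real.pi_pos
  have hε0 : 0 ≤ ε := (abs_nonneg _).trans (hε t ⟨ht.1.le, ht.2.le⟩)
  have hcont : Continuous fun s => ψ₂ s - ψ₁ s := h₂.continuous.sub h₁.continuous
  have hsub : kappa ψ₁ t - kappa ψ₂ t = (∫ s in (-1 : ℝ)..t, (ψ₂ s - ψ₁ s)) / (1 - t ^ 2) := by
    rw [h₁.kappa_eq_kappaAux ht, h₂.kappa_eq_kappaAux ht, kappaAux, kappaAux, ← sub_div,
      ← intervalIntegral.integral_sub (h₁.continuous_defect.intervalIntegrable _ _)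
        (h₂.continuous_defect.intervalIntegrable _ _), div_eq_div_iff (by
          have := one_sub_sq_pos ht; positivity) (one_sub_sq_pos ht).ne']
    have : ∀ s, 1 - 4 * Real.pi * ψ₁ s - (1 - 4 * Real.pi * ψ₂ s) =
        4 * Real.pi * (ψ₂ s - ψ₁ s) := fun s => by ring
    simp only [this, intervalIntegral.integral_const_mul]
    ring
  have htot : ∫ s in (-1 : ℝ)..1, (ψ₂ s - ψ₁ s) = 0 := by
    rw [intervalIntegral.integral_sub (h₂.continuous.intervalIntegrable _ _)
      (h₁.continuous.intervalIntegrable _ _), h₁.integral_eq, h₂.integral_eq, sub_self]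
  have hl : |∫ s in (-1 : ℝ)..t, (ψ₂ s - ψ₁ s)| ≤ ε * (t + 1) := by
    have := intervalIntegral.norm_integral_le_of_norm_le_const (a := -1) (b := t) (C := ε)
      (f := fun s => ψ₂ s - ψ₁ s) fun s hs => by
        rw [uIoc_of_le ht.1.le] at hs
        rw [Real.norm_eq_abs, abs_sub_comm]
        exact hε s ⟨hs.1.le, hs.2.trans ht.2.le⟩
    rwa [sub_neg_eq_add, abs_of_pos (by linarith [ht.1]), Real.norm_eq_abs] at this
  have hr : |∫ s in (-1 : ℝ)..t, (ψ₂ s - ψ₁ s)| ≤ ε * (1 - t) := by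
    have h3 := intervalIntegral.integral_add_adjacent_intervals
      (hcont.intervalIntegrable (μ := volume) (-1) t) (hcont.intervalIntegrable t 1)
    rw [htot] at h3
    have := intervalIntegral.norm_integral_le_of_norm_le_const (a := t) (b := 1) (C := ε)
      (f := fun s => ψ₂ s - ψ₁ s) fun s hs => by
        rw [uIoc_of_le ht.2.le] at hs
        rw [Real.norm_eq_abs, abs_sub_comm]
        exact hε s ⟨ht.1.le.trans hs.1.le, hs.2⟩
    rw [abs_of_pos (by linarith [ht.2]), Real.norm_eq_abs] at this
    rwa [eq_neg_of_add_eq_zero_left h3, abs_neg]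
  change |kappa ψ₁ t - kappa ψ₂ t| ≤ ε
  rw [hsub, abs_div, abs_of_pos (one_sub_sq_pos ht), div_le_iff₀ (one_sub_sq_pos ht)]
  rcases le_total 0 t with h | h
  · nlinarith [mul_nonneg hε0 (mul_nonneg h (sub_nonneg.2 ht.2.le))]
  · have : -1 < t := ht.1
    nlinarith [mul_nonneg hε0 (mul_nonneg (neg_nonneg.2 h) (by linarith : 0 ≤ t + 1))]

/-- The derivative need not be bounded near `±1`. The weight `1 - t² = ‖x × y‖²` is the size of `Q`
and `V`, so the weighted bound is what the kernel requires. -/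
lemma IsProfile.abs_deriv_kappa_sub_le {ψ₁ ψ₂ : ℝ → ℝ} (h₁ : IsProfile ψ₁) (h₂ : IsProfile ψ₂)
    {ε : ℝ} (hε : ∀ t ∈ Icc (-1 : ℝ) 1, |ψ₁ t - ψ₂ t| ≤ ε) {t : ℝ} (ht : t ∈ Ioo (-1 : ℝ) 1) :
    (1 - t ^ 2) * |deriv (kappa ψ₁) t - deriv (kappa ψ₂) t| ≤ 3 * ε := by
  have ht' : t ∈ Icc (-1 : ℝ) 1 := ⟨ht.1.le, ht.2.le⟩
  have hp := one_sub_sq_pos ht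
  rw [h₁.deriv_kappa ht, h₂.deriv_kappa ht, ← sub_div, abs_div, abs_of_pos hp,
    mul_div_cancel₀ _ hp.ne']
  have e : 2 * t * kappa ψ₁ t + ((4 * Real.pi)⁻¹ - ψ₁ t) -
      (2 * t * kappa ψ₂ t + ((4 * Real.pi)⁻¹ - ψ₂ t)) =
      2 * t * (kappa ψ₁ t - kappa ψ₂ t) - (ψ₁ t - ψ₂ t) := by ring
  have hk := h₁.abs_kappa_sub_le h₂ hε t ht'
  have h4 : |2 * t * (kappa ψ₁ t - kappa ψ₂ t)| ≤ 2 * ε := by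
    rw [abs_mul, abs_mul, abs_two]
    have : |t| ≤ 1 := abs_le.2 ht'
    nlinarith [abs_nonneg t, abs_nonneg (kappa ψ₁ t - kappa ψ₂ t)]
  rw [e]
  linarith [abs_sub (2 * t * (kappa ψ₁ t - kappa ψ₂ t)) (ψ₁ t - ψ₂ t), hε t ht']

lemma IsProfile.exists_bound {ψ : ℝ → ℝ} (hψ : IsProfile ψ) :
    ∃ B, 0 ≤ B ∧ (∀ t ∈ Icc (-1 : ℝ) 1, |kappa ψ t| ≤ B) ∧
      ∀ t ∈ Ioo (-1 : ℝ) 1, (1 - t ^ 2) * |deriv (kappa ψ) t| ≤ B := by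
  obtain ⟨B₁, hB₁⟩ := isCompact_Icc.exists_bound_of_continuousOn hψ.continuousOn_kappa
  obtain ⟨B₂, hB₂⟩ := isCompact_Icc.exists_bound_of_continuousOn
    (s := Icc (-1 : ℝ) 1) (f := fun t => (4 * Real.pi)⁻¹ - ψ t)
    (continuous_const.sub hψ.continuous).continuousOn
  have h1 := (norm_nonneg _).trans (hB₁ 0 (by norm_num))
  have h2 := (norm_nonneg _).trans (hB₂ 0 (by norm_num))
  refine ⟨2 * B₁ + B₂, by positivity, fun t ht => (hB₁ t ht).trans (by linarith), fun t ht => ?_⟩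
  have ht' : t ∈ Icc (-1 : ℝ) 1 := ⟨ht.1.le, ht.2.le⟩
  have hp := one_sub_sq_pos ht
  rw [hψ.deriv_kappa ht, abs_div, abs_of_pos hp, mul_div_cancel₀ _ hp.ne']
  refine (abs_add_le _ _).trans (add_le_add ?_ (hB₂ t ht'))
  rw [abs_mul, abs_mul, abs_two]
  have h3 : |t| ≤ 1 := abs_le.2 ht'
  have h4 := hB₁ t ht'
  rw [Real.norm_eq_abs] at h4
  nlinarith [abs_nonneg t, abs_nonneg (kappa ψ t)]

open Polynomial in
lemma exists_derivative_eq (q : ℝ[X]) : ∃ g : ℝ[X], derivative g = q := by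
  induction q using Polynomial.induction_on' with
  | add p q hp hq =>
    obtain ⟨f, rfl⟩ := hp
    obtain ⟨g, rfl⟩ := hq
    exact ⟨f + g, derivative_add⟩
  | monomial n a =>
    refine ⟨monomial (n + 1) (a / (n + 1)), ?_⟩
    have : (n + 1 : ℝ) ≠ 0 := by positivity
    rw [derivative_monomial]
    simp [div_mul_cancel₀ _ this]

open Polynomial in
/-- For a polynomial profile `κ` is a polynomial. -/
lemma IsProfile.exists_polynomial_kappa {q : ℝ[X]} (hq : IsProfile q.eval) :
    ∃ k : ℝ[X], (∀ t ∈ Icc (-1 : ℝ) 1, kappa q.eval t = k.eval t) ∧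
      (∀ t ∈ Ioo (-1 : ℝ) 1, deriv (kappa q.eval) t = (derivative k).eval t) ∧
      derivative ((1 - X ^ 2) * k) = C (4 * Real.pi)⁻¹ - q := by
  have hpi := Real.pi_ne_zero
  obtain ⟨N, hN⟩ := exists_derivative_eq (C (4 * Real.pi)⁻¹ - q)
  have hint (t : ℝ) : ∫ s in (-1 : ℝ)..t, (1 - 4 * Real.pi * q.eval s) =
      4 * Real.pi * (N.eval t - N.eval (-1)) := by
    rw [← intervalIntegral.integral_eq_sub_of_hasDerivAt (fun t _ => N.hasDerivAt t)
      ((Polynomial.continuous _).intervalIntegrable _ _), ← intervalIntegral.integral_const_mul, hN]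
    refine intervalIntegral.integral_congr fun s _ => ?_
    simp
    field_simp
  have h1 : N.eval 1 - N.eval (-1) = 0 := by
    have := hint 1
    rw [hq.integral_defect] at this
    simpa [hpi] using this.symm
  -- The primitive vanishing at `-1` also vanishes at `1` by normalization, so the denominator of
  -- `κ` divides out.
  obtain ⟨k, hk⟩ : (1 - X ^ 2 : ℝ[X]) ∣ N - C (N.eval (-1)) := by
    have e : (1 - X ^ 2 : ℝ[X]) = -((X - C 1) * (X - C (-1))) := by simp; ring
    rw [e, neg_dvd]
    refine IsCoprime.mul_dvd ?_ ?_ ?_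
    · exact isCoprime_X_sub_C_of_isUnit_sub (by norm_num)
    · rw [dvd_iff_isRoot]; simpa using h1
    · rw [dvd_iff_isRoot]; simp
  have hIoo : ∀ t ∈ Ioo (-1 : ℝ) 1, kappa q.eval t = k.eval t := fun t ht => by
    have h := congrArg (eval t) hk
    simp only [eval_sub, eval_C, eval_mul, eval_one, eval_pow, eval_X] at h
    have := (one_sub_sq_pos ht).ne'
    rw [hq.kappa_eq_kappaAux ht, kappaAux, hint, h]
    field_simp
  refine ⟨k, ?_, fun t ht => ?_, ?_⟩
  · rw [← closure_Ioo (by norm_num)]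
    refine EqOn.of_subset_closure hIoo ?_ k.continuous.continuousOn subset_closure subset_rfl
    rw [closure_Ioo (by norm_num)]
    exact hq.continuousOn_kappa
  · rw [← Polynomial.deriv]
    refine Filter.EventuallyEq.deriv_eq ?_
    filter_upwards [isOpen_Ioo.mem_nhds ht] with s hs using hIoo s hs
  · rw [← hk, ← hN]
    simp

/-! ### The kernels in vector form -/

lemma cross_apply_zero (v w : E3) : cross v w 0 = v 1 * w 2 - v 2 * w 1 := by
  simp [cross, cross_apply]

lemma cross_apply_one (v w : E3) : cross v w 1 = v 2 * w 0 - v 0 * w 2 := by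
  simp [cross, cross_apply]

lemma cross_apply_two (v w : E3) : cross v w 2 = v 0 * w 1 - v 1 * w 0 := by
  simp [cross, cross_apply]

lemma inner_eq_sum (v w : E3) : inner ℝ v w = v 0 * w 0 + v 1 * w 1 + v 2 * w 2 := by
  simp [PiLp.inner_apply, Fin.sum_univ_three, mul_comm]

lemma norm_cross_sq (v w : E3) : ‖cross v w‖ ^ 2 = ‖v‖ ^ 2 * ‖w‖ ^ 2 - inner ℝ v w ^ 2 := by
  simp only [EuclideanSpace.real_norm_sq_eq, Fin.sum_univ_three, cross_apply_zero, cross_apply_one,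
    cross_apply_two, inner_eq_sum]
  ring

lemma norm_cross_le (v w : E3) : ‖cross v w‖ ≤ ‖v‖ * ‖w‖ := by
  refine abs_le_of_sq_le_sq' ?_ (by positivity) |>.2
  rw [norm_cross_sq, mul_pow]
  linarith [sq_nonneg (inner ℝ v w)]

lemma inner_cross_left (u v w : E3) : inner ℝ (cross u v) w = inner ℝ v (cross w u) := by
  simp only [inner_eq_sum, cross_apply_zero, cross_apply_one, cross_apply_two]
  ring

lemma inner_cross_right (u v w : E3) : inner ℝ u (cross v w) = inner ℝ (cross u v) w := by
  simp only [inner_eq_sum, cross_apply_zero, cross_apply_one, cross_apply_two]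
  ring

lemma cross_swap (v w : E3) : cross v w = -cross w v := by
  ext i; fin_cases i <;> simp [cross_apply_zero, cross_apply_one, cross_apply_two] <;> ring

/-- The cross product with a fixed left factor. -/
def crossLeft (v : E3) : E3 →L[ℝ] E3 :=
  LinearMap.toContinuousLinearMap
    { toFun := cross v
      map_add' := fun u w => by simp [cross]
      map_smul' := fun r w => by simp [cross] }

@[simp] lemma crossLeft_apply (v w : E3) : crossLeft v w = cross v w := rfl

lemma continuous_cross : Continuous fun z : E3 × E3 => cross z.1 z.2 := by
  refine (PiLp.continuous_toLp 2 _).comp (continuous_pi fun i => ?_)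
  fin_cases i <;> simp [cross_apply] <;> fun_prop

/-- The vector `(a Q(x,y) + b R(x,y)) v`. -/
def divApply (a b : ℝ) (x y v : E3) : E3 :=
  -(a * inner ℝ (cross x y) v) • cross x y + b • (inner ℝ x y • v - inner ℝ x v • y)

lemma outer_mulVec (v w u : E3) :
    outer v w *ᵥ WithLp.ofLp u = inner ℝ w u • WithLp.ofLp v := by
  ext i
  fin_cases i <;> simp [outer, Matrix.mulVec, dotProduct, Matrix.vecMulVec_apply,
    Fin.sum_univ_three, inner_eq_sum] <;> ring

lemma toLp_mulVec_div (a b : ℝ) (x y v : E3) :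
    WithLp.toLp 2 ((a • matQ x y + b • matR x y) *ᵥ WithLp.ofLp v) = divApply a b x y v := by
  simp only [matQ, matR, Matrix.add_mulVec, Matrix.smul_mulVec, Matrix.neg_mulVec,
    Matrix.sub_mulVec, Matrix.one_mulVec, outer_mulVec, divApply]
  ext i
  simp
  ring

/-- For unit vectors, `V` and `W` arise from `Q` and `R` by `x × ·` on the left and `· × y` on the
argument. The curl-free kernel thus needs no analysis of its own. -/
lemma toLp_mulVec_curl (a b : ℝ) {x y : E3} (hx : ‖x‖ = 1) (hy : ‖y‖ = 1) (v : E3) :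
    WithLp.toLp 2 ((a • matV x y + b • matW x y) *ᵥ WithLp.ofLp v) =
      cross x (divApply a b x y (cross v y)) := by
  have hx2 : x 0 * x 0 + x 1 * x 1 + x 2 * x 2 = 1 := by
    rw [← inner_eq_sum, real_inner_self_eq_norm_sq, hx, one_pow]
  have hy2 : y 0 * y 0 + y 1 * y 1 + y 2 * y 2 = 1 := by
    rw [← inner_eq_sum, real_inner_self_eq_norm_sq, hy, one_pow]
  have h1 : y - inner ℝ x y • x = cross (cross x y) x := by
    ext i
    fin_cases i <;> simp [cross_apply_zero, cross_apply_one, cross_apply_two, inner_eq_sum]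
    · linear_combination -y 0 * hx2
    · linear_combination -y 1 * hx2
    · linear_combination -y 2 * hx2
  have h2 : x - inner ℝ x y • y = cross y (cross x y) := by
    ext i
    fin_cases i <;> simp [cross_apply_zero, cross_apply_one, cross_apply_two, inner_eq_sum]
    · linear_combination -x 0 * hy2
    · linear_combination -x 1 * hy2
    · linear_combination -x 2 * hy2
  have h3 (u : E3) : u - inner ℝ y u • y = cross y (cross u y) := by
    ext i
    fin_cases i <;> simp [cross_apply_zero, cross_apply_one, cross_apply_two, inner_eq_sum]
    · linear_combination -u 0 * hy2
    · linear_combination -u 1 * hy2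
    · linear_combination -u 2 * hy2
  have h4 (u : E3) : u - inner ℝ x u • x = cross x (cross u x) := by
    ext i
    fin_cases i <;> simp [cross_apply_zero, cross_apply_one, cross_apply_two, inner_eq_sum]
    · linear_combination -u 0 * hx2
    · linear_combination -u 1 * hx2
    · linear_combination -u 2 * hx2
  have hW : matW x y *ᵥ WithLp.ofLp v =
      WithLp.ofLp (cross x (cross (cross y (cross v y)) x)) := by
    rw [← h3, ← h4, matW, ← Matrix.mulVec_mulVec]
    rw [Matrix.sub_mulVec 1 (outer y y), Matrix.one_mulVec, outer_mulVec]
    have : WithLp.ofLp v - inner ℝ y v • WithLp.ofLp y = WithLp.ofLp (v - inner ℝ y v • y) := by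
      simp
    rw [this, Matrix.sub_mulVec, Matrix.one_mulVec, outer_mulVec]
    simp
  rw [Matrix.add_mulVec, Matrix.smul_mulVec, Matrix.smul_mulVec, hW, matV, outer_mulVec, h1, h2]
  ext i
  fin_cases i <;> simp [divApply, cross_apply_zero, cross_apply_one, cross_apply_two,
    inner_eq_sum] <;> ring

/-- The vector `(a Q(x,y) + b R(x,y) + a V(x,y) + b W(x,y)) v` for unit vectors `x`, `y`. -/
def kernelApply (a b : ℝ) (x y v : E3) : E3 :=
  divApply a b x y v + cross x (divApply a b x y (cross v y))

lemma convIntegrand_eq (ψ : ℝ → ℝ) (f : S2 → E3) (x y : S2) :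
    convIntegrand ψ f x y = kernelApply (deriv (kappa ψ) (inner ℝ (x : E3) y))
      (kappa ψ (inner ℝ (x : E3) y)) x y (f y) := by
  rw [convIntegrand, kernel, kernelDiv, kernelCurl, Matrix.add_mulVec, kernelApply,
    ← toLp_mulVec_div, ← toLp_mulVec_curl _ _ (norm_eq_of_mem_sphere x) (norm_eq_of_mem_sphere y)]
  rfl

lemma norm_divApply_le (a b : ℝ) (x y : S2) (v : E3) :
    ‖divApply a b x y v‖ ≤ ((1 - inner ℝ (x : E3) y ^ 2) * |a| + 2 * |b|) * ‖v‖ := by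
  have hc := norm_cross_sq (x : E3) y
  simp only [norm_eq_of_mem_sphere, one_pow, mul_one] at hc
  have h1 : ‖-(a * inner ℝ (cross x y) v) • cross x y‖ ≤
      (1 - inner ℝ (x : E3) y ^ 2) * |a| * ‖v‖ := by
    rw [norm_smul, norm_neg, norm_mul, ← hc, Real.norm_eq_abs, Real.norm_eq_abs]
    have := abs_real_inner_le_norm (cross x y) v
    calc |a| * |inner ℝ (cross x y) v| * ‖cross x y‖
        ≤ |a| * (‖cross (x : E3) y‖ * ‖v‖) * ‖cross (x : E3) y‖ := by gcongr
      _ = _ := by ring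
  have h2 : ‖b • (inner ℝ (x : E3) y • v - inner ℝ (x : E3) v • (y : E3))‖ ≤ 2 * |b| * ‖v‖ := by
    have e1 : |inner ℝ (x : E3) y| ≤ 1 := abs_le.2 (inner_mem_Icc x y)
    have e2 : |inner ℝ (x : E3) v| ≤ ‖v‖ := by
      simpa using abs_real_inner_le_norm (x : E3) v
    rw [norm_smul, Real.norm_eq_abs]
    calc |b| * ‖inner ℝ (x : E3) y • v - inner ℝ (x : E3) v • (y : E3)‖
        ≤ |b| * (‖inner ℝ (x : E3) y • v‖ + ‖inner ℝ (x : E3) v • (y : E3)‖) := by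
          gcongr; exact norm_sub_le _ _
      _ ≤ |b| * (1 * ‖v‖ + ‖v‖ * 1) := by
          rw [norm_smul, norm_smul, norm_eq_of_mem_sphere, Real.norm_eq_abs, Real.norm_eq_abs]
          gcongr
      _ = _ := by ring
  calc _ ≤ _ := norm_add_le _ _
    _ ≤ _ := add_le_add h1 h2
    _ = _ := by ring

lemma divApply_sub (a a' b b' : ℝ) (x y v : E3) :
    divApply a b x y v - divApply a' b' x y v = divApply (a - a') (b - b') x y v := by
  simp only [divApply]
  module

lemma cross_eq_zero_of_inner_notMem {x y : S2} (h : inner ℝ (x : E3) y ∉ Ioo (-1 : ℝ) 1) :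
    cross (x : E3) y = 0 := by
  have hc := norm_cross_sq (x : E3) y
  simp only [norm_eq_of_mem_sphere, one_pow, mul_one] at hc
  have hI := inner_mem_Icc x y
  have : inner ℝ (x : E3) y = -1 ∨ inner ℝ (x : E3) y = 1 := by
    by_contra! hne
    exact h ⟨lt_of_le_of_ne hI.1 hne.1.symm, lt_of_le_of_ne hI.2 hne.2⟩
  rw [← norm_eq_zero, ← sq_eq_zero_iff, hc]
  rcases this with e | e <;> rw [e] <;> norm_num

/-- The coefficient of `Q` is immaterial where `x = ± y`. -/
lemma divApply_congr {a a' b b' : ℝ} {x y : S2} (hb : b = b')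
    (ha : inner ℝ (x : E3) y ∈ Ioo (-1 : ℝ) 1 → a = a') (v : E3) :
    divApply a b x y v = divApply a' b' x y v := by
  by_cases h : inner ℝ (x : E3) y ∈ Ioo (-1 : ℝ) 1
  · rw [ha h, hb]
  · simp [divApply, cross_eq_zero_of_inner_notMem h, hb]

lemma norm_divApply_le_of_bounds {a b A B : ℝ} {x y : S2} (hb : |b| ≤ B) (hA : 0 ≤ A)
    (ha : inner ℝ (x : E3) y ∈ Ioo (-1 : ℝ) 1 → (1 - inner ℝ (x : E3) y ^ 2) * |a| ≤ A) (v : E3) :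
    ‖divApply a b x y v‖ ≤ (A + 2 * B) * ‖v‖ := by
  by_cases h : inner ℝ (x : E3) y ∈ Ioo (-1 : ℝ) 1
  · exact (norm_divApply_le a b x y v).trans (by gcongr; exact ha h)
  · rw [divApply_congr (a' := 0) rfl fun h' => absurd h' h]
    refine (norm_divApply_le 0 b x y v).trans ?_
    rw [abs_zero, mul_zero]
    gcongr

lemma norm_kernelApply_le_of_bounds {a b A B : ℝ} {x y : S2} (hb : |b| ≤ B) (hA : 0 ≤ A)
    (ha : inner ℝ (x : E3) y ∈ Ioo (-1 : ℝ) 1 → (1 - inner ℝ (x : E3) y ^ 2) * |a| ≤ A) (v : E3) :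
    ‖kernelApply a b x y v‖ ≤ 2 * (A + 2 * B) * ‖v‖ := by
  have hB : 0 ≤ B := (abs_nonneg b).trans hb
  have h1 := norm_divApply_le_of_bounds hb hA ha v
  have h2 := norm_divApply_le_of_bounds hb hA ha (cross v y)
  have h3 : ‖cross v (y : E3)‖ ≤ ‖v‖ := by simpa using norm_cross_le v y
  have h4 := norm_cross_le x (divApply a b x y (cross v y))
  rw [norm_eq_of_mem_sphere, one_mul] at h4
  have h5 : (A + 2 * B) * ‖cross v (y : E3)‖ ≤ (A + 2 * B) * ‖v‖ := by gcongr
  calc _ ≤ _ := norm_add_le _ _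
    _ ≤ _ := add_le_add h1 (h4.trans (h2.trans h5))
    _ = _ := by ring

lemma inner_divApply (a b : ℝ) (x y v w : E3) :
    inner ℝ (divApply a b x y v) w = inner ℝ v (divApply a b y x w) := by
  simp only [divApply, inner_eq_sum, PiLp.add_apply, PiLp.sub_apply, PiLp.smul_apply, smul_eq_mul,
    cross_apply_zero, cross_apply_one, cross_apply_two]
  ring

lemma inner_kernelApply (a b : ℝ) (x y v w : E3) :
    inner ℝ (kernelApply a b x y v) w = inner ℝ v (kernelApply a b y x w) := by
  rw [kernelApply, kernelApply, inner_add_left, inner_add_right, inner_divApply, inner_cross_left,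
    inner_divApply, inner_cross_right v y]

lemma inner_self_kernelApply (a b : ℝ) (x : S2) (y v : E3) :
    inner ℝ (x : E3) (kernelApply a b x y v) = 0 := by
  have hx2 := sum_sq_coe x
  have h1 : ∀ u, inner ℝ (x : E3) (cross x u) = 0 := fun u => by
    simp only [inner_eq_sum, cross_apply_zero, cross_apply_one, cross_apply_two]
    ring
  simp only [kernelApply, divApply, inner_add_right, inner_sub_right, inner_smul_right, h1]
  ring

/-! ### The divergence-free kernel acting on polynomial fields -/

lemma sphereFunctional_angular_mul (i : Fin 3) (p q : Poly) :
    sphereFunctional (angular i p * q) = -sphereFunctional (p * angular i q) := by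
  have h := sphereFunctional_angular i (p * q)
  rw [Derivation.leibniz, map_add, smul_eq_mul, smul_eq_mul] at h
  rw [mul_comm (angular i p) q]
  linarith

lemma angular_aeval (i : Fin 3) (P : Poly) (g : Polynomial ℝ) :
    angular i (Polynomial.aeval P g) =
      Polynomial.aeval P (Polynomial.derivative g) * angular i P := by
  rw [Derivation.map_aeval, smul_eq_mul]

lemma pderiv_linearForm (i : Fin 3) (e : E3) :
    MvPolynomial.pderiv i (linearForm e) = MvPolynomial.C (e i) := by
  simp only [linearForm, map_sum, Derivation.leibniz, MvPolynomial.pderiv_C,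
    MvPolynomial.pderiv_X, smul_eq_mul]
  rw [Finset.sum_eq_single i] <;> simp +contextual [eq_comm]

lemma peval_angular_linearForm (i : Fin 3) (x y : E3) :
    peval (angular i (linearForm x)) y = -cross x y i := by
  rw [angular_apply, pderiv_linearForm, pderiv_linearForm]
  fin_cases i <;> simp [cross_apply_zero, cross_apply_one, cross_apply_two] <;> ring

lemma peval_angular_angular_linearForm (i j : Fin 3) (x y : E3) :
    peval (angular j (angular i (linearForm x))) y =
      -((if i = j then inner ℝ x y else 0) - y i * x j) := by
  simp only [angular_apply i, pderiv_linearForm]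
  rw [angular_apply]
  fin_cases i <;> fin_cases j <;>
    simp [MvPolynomial.pderiv_X, inner_eq_sum] <;> ring

/-- The chain rule for `g(x·y)`: the product of first angular derivatives of `x·y` yields `Q`, the
second angular derivatives yield `R`. -/
lemma divApply_apply (k : Polynomial ℝ) (g : Polynomial ℝ) (hg : Polynomial.derivative g = k)
    (x y : E3) (F : Fin 3 → Poly) (i : Fin 3) :
    divApply ((Polynomial.derivative k).eval (inner ℝ x y)) (k.eval (inner ℝ x y)) x y
      (WithLp.toLp 2 fun j => peval (F j) y) i =
    peval (-∑ j, angular j (angular i (Polynomial.aeval (linearForm x) g)) * F j) y := by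
  simp only [angular_aeval, hg, Derivation.leibniz, smul_eq_mul, peval_neg, peval_sum, peval_mul,
    peval_add, peval_aeval, peval_linearForm, peval_angular_linearForm,
    peval_angular_angular_linearForm]
  generalize (Polynomial.derivative k).eval (inner ℝ x y) = a
  generalize k.eval (inner ℝ x y) = b
  simp only [divApply, Fin.sum_univ_three, PiLp.add_apply, PiLp.sub_apply, PiLp.smul_apply,
    smul_eq_mul]
  rw [inner_eq_sum (cross x y), inner_eq_sum x (WithLp.toLp 2 fun j => peval (F j) y)]
  fin_cases i <;> simp <;> ring

/-- The field with polynomial components `F`. -/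
def polyField (F : Fin 3 → Poly) (y : E3) : E3 := WithLp.toLp 2 fun j => peval (F j) y

lemma continuous_polyField (F : Fin 3 → Poly) : Continuous (polyField F) :=
  (PiLp.continuous_toLp 2 _).comp (continuous_pi fun j => continuous_peval (F j))

/-- The operator with kernel `κ'(t) Q + κ(t) R`. -/
def convDiv (ψ : ℝ → ℝ) (F : S2 → E3) (x : S2) : E3 :=
  ∫ y : S2, divApply (deriv (kappa ψ) (inner ℝ (x : E3) y)) (kappa ψ (inner ℝ (x : E3) y)) x y (F y)
    ∂surfaceMeasure

/-- Integrating by parts twice moves both angular derivatives from `g(x·y)` to the field. The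
polynomials depend only on `q`, and the equation for `k` records how `κ` was chosen. -/
lemma convDiv_polynomial {q : Polynomial ℝ} (hq : IsProfile q.eval) :
    ∃ k g : Polynomial ℝ, Polynomial.derivative g = k ∧
      Polynomial.derivative ((1 - Polynomial.X ^ 2) * k) = Polynomial.C (4 * Real.pi)⁻¹ - q ∧
      ∀ (F : Fin 3 → Poly) (x : S2), convDiv q.eval (fun y => polyField F y) x =
        WithLp.toLp 2 fun i => -sphereFunctional
          (Polynomial.aeval (linearForm x) g * angular i (∑ j, angular j (F j))) := by
  obtain ⟨k, hk, hk', hkq⟩ := hq.exists_polynomial_kappa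
  obtain ⟨g, hg⟩ := exists_derivative_eq k
  refine ⟨k, g, hg, hkq, fun F x => ?_⟩
  have h1 (y : S2) : divApply (deriv (kappa q.eval) (inner ℝ (x : E3) y))
      (kappa q.eval (inner ℝ (x : E3) y)) x y (polyField F y) =
      polyField (fun i => -∑ j, angular j (angular i (Polynomial.aeval (linearForm x) g)) * F j)
        y := by
    rw [divApply_congr (hk _ (inner_mem_Icc x y)) (hk' _)]
    ext i
    exact divApply_apply k g hg x y F i
  simp only [convDiv, h1]
  ext i
  have h2 := (EuclideanSpace.proj i : E3 →L[ℝ] ℝ).integral_comp_comm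
    (integrable_of_continuous ((continuous_polyField (fun i => -∑ j, angular j
      (angular i (Polynomial.aeval (linearForm x) g)) * F j)).comp continuous_subtype_val))
  simp only [Function.comp_apply] at h2
  refine h2.symm.trans ?_
  change sphereFunctional (-∑ j, angular j (angular i (Polynomial.aeval (linearForm x) g)) * F j) =
    _
  rw [map_neg, map_sum]
  simp only [sphereFunctional_angular_mul, neg_neg, map_sum, Finset.mul_sum]

/-- The angular Laplacian is symmetric. On `p` it gives `-λ_ℓ`; on `g(x·y)` it gives `((1 - t²) g')'
= 1/(4π) - q`. The constant integrates to zero against `p` since `ℓ ≠ 0`, and Funk–Hecke evaluates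
the rest. -/
lemma sphereFunctional_aeval_mul_eigenvalue {ℓ : ℕ} (hℓ : ℓ ≠ 0) {p : Poly}
    (hp : IsSolidHarmonic ℓ p) {k g q : Polynomial ℝ} (hg : Polynomial.derivative g = k)
    (hk : Polynomial.derivative ((1 - Polynomial.X ^ 2) * k) = Polynomial.C (4 * Real.pi)⁻¹ - q)
    (x : S2) :
    eigenvalue ℓ * sphereFunctional (Polynomial.aeval (linearForm x) g * p) =
      zonalCoeff q.eval ℓ * peval p x := by
  set G := Polynomial.aeval (linearForm x) g with hG
  have h1 : sphereFunctional (∑ i, angular i (angular i G) * p) =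
      -eigenvalue ℓ * sphereFunctional (G * p) := by
    rw [map_sum]
    simp only [sphereFunctional_angular_mul, neg_neg]
    rw [← map_sum, ← Finset.mul_sum, sum_angular_angular hp, mul_left_comm,
      ← MvPolynomial.smul_eq_C_mul, map_smul, smul_eq_mul]
  have h2 : sphereFunctional (∑ i, angular i (angular i G) * p) =
      sphereFunctional ((4 * Real.pi)⁻¹ • p - Polynomial.aeval (linearForm x) q * p) := by
    refine sphereFunctional_congr fun y => ?_
    have h3 := congrArg (Polynomial.eval (inner ℝ (x : E3) y)) hk
    have hc := norm_cross_sq (x : E3) y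
    rw [EuclideanSpace.real_norm_sq_eq, Fin.sum_univ_three] at hc
    simp only [norm_eq_of_mem_sphere, one_pow, mul_one] at hc
    simp [Polynomial.derivative_mul, -mul_inv_rev] at h3
    simp only [hG, angular_aeval, hg, Derivation.leibniz, smul_eq_mul, peval_mul,
      peval_sub, peval_smul, peval_add, peval_aeval, peval_linearForm, peval_angular_linearForm,
      peval_angular_angular_linearForm, Fin.sum_univ_three, if_true]
    have hi := inner_eq_sum (x : E3) y
    linear_combination peval p y * h3 +
      peval p y * (Polynomial.derivative k).eval (inner ℝ (x : E3) y) * hc -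
      k.eval (inner ℝ (x : E3) y) * peval p y * hi
  have h3 : sphereFunctional p = 0 := sphereFunctional_eq_zero_of_isSolidHarmonic hp hℓ
  rw [map_sub, map_smul, h3, smul_zero, zero_sub,
    sphereFunctional_aeval_linearForm_mul q hp, h1] at h2
  linarith

/-- The components of `x × ∇ p`. -/
def curlField (p : Poly) : Fin 3 → Poly := fun i => angular i p

/-- The components of `∇ p - ℓ p x`. -/
def gradField (ℓ : ℕ) (p : Poly) : Fin 3 → Poly := fun i =>
  MvPolynomial.pderiv i p - MvPolynomial.C (ℓ : ℝ) * (p * MvPolynomial.X i)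

/-- Surface gradients are curl-free: second derivatives commute, and the radial correction cancels
because `(x × ∇) · (p x) = 0`. -/
lemma sum_angular_gradField (ℓ : ℕ) (p : Poly) : ∑ j, angular j (gradField ℓ p j) = 0 := by
  simp only [gradField, angular_apply, Fin.sum_univ_three, map_sub, Derivation.leibniz,
    smul_eq_mul, Fin.isValue, Fin.reduceAdd, zero_add, MvPolynomial.pderiv_X, MvPolynomial.pderiv_C,
    Pi.single_apply, Fin.reduceEq, if_false, mul_zero, pderiv_comm 1 0,
    pderiv_comm 2 0, pderiv_comm 2 1]
  ring

lemma convDiv_curlField_polynomial {q : Polynomial ℝ} (hq : IsProfile q.eval) {ℓ : ℕ} (hℓ : ℓ ≠ 0)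
    {p : Poly} (hp : IsSolidHarmonic ℓ p) (x : S2) :
    convDiv q.eval (fun y => polyField (curlField p) y) x =
      zonalCoeff q.eval ℓ • polyField (curlField p) x := by
  obtain ⟨k, g, hg, hk, h⟩ := convDiv_polynomial hq
  rw [h]
  ext i
  change -_ = zonalCoeff q.eval ℓ * peval (angular i p) x
  rw [← sphereFunctional_aeval_mul_eigenvalue hℓ (hp.angular i) hg hk]
  simp only [curlField, sum_angular_angular hp]
  rw [← MvPolynomial.smul_eq_C_mul, Derivation.map_smul, mul_smul_comm, map_smul, smul_eq_mul]
  ring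

lemma convDiv_gradField_polynomial {q : Polynomial ℝ} (hq : IsProfile q.eval) (ℓ : ℕ)
    (p : Poly) (x : S2) :
    convDiv q.eval (fun y => polyField (gradField ℓ p) y) x = 0 := by
  obtain ⟨k, g, hg, hk, h⟩ := convDiv_polynomial hq
  rw [h]
  ext i
  simp [sum_angular_gradField]

/-! ### The convolution operators -/

lemma continuous_inner_coe : Continuous fun z : S2 × S2 => inner ℝ (z.1 : E3) z.2 := by fun_prop

lemma IsProfile.continuous_kappa_inner {ψ : ℝ → ℝ} (hψ : IsProfile ψ) :
    Continuous fun z : S2 × S2 => kappa ψ (inner ℝ (z.1 : E3) z.2) :=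
  hψ.continuousOn_kappa.comp_continuous continuous_inner_coe fun z => inner_mem_Icc z.1 z.2

lemma measurable_deriv_kappa_inner (ψ : ℝ → ℝ) :
    Measurable fun z : S2 × S2 => deriv (kappa ψ) (inner ℝ (z.1 : E3) z.2) :=
  (measurable_deriv _).comp continuous_inner_coe.measurable

lemma aestronglyMeasurable_cross {α : Type*} [MeasurableSpace α] {ν : Measure α} {u v : α → E3}
    (hu : AEStronglyMeasurable u ν) (hv : AEStronglyMeasurable v ν) :
    AEStronglyMeasurable (fun z => cross (u z) (v z)) ν :=
  continuous_cross.comp_aestronglyMeasurable (hu.prodMk hv)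

lemma aestronglyMeasurable_divApply {α : Type*} [MeasurableSpace α] {ν : Measure α} {a b : α → ℝ}
    {x y v : α → E3} (ha : AEStronglyMeasurable a ν) (hb : AEStronglyMeasurable b ν)
    (hx : AEStronglyMeasurable x ν) (hy : AEStronglyMeasurable y ν)
    (hv : AEStronglyMeasurable v ν) :
    AEStronglyMeasurable (fun z => divApply (a z) (b z) (x z) (y z) (v z)) ν := by
  have hc := aestronglyMeasurable_cross hx hy
  have h1 : AEStronglyMeasurable (fun z => (inner ℝ (cross (x z) (y z)) (v z) : ℝ)) ν := hc.inner hv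
  have h2 : AEStronglyMeasurable (fun z => (inner ℝ (x z) (y z) : ℝ)) ν := hx.inner hy
  have h3 : AEStronglyMeasurable (fun z => (inner ℝ (x z) (v z) : ℝ)) ν := hx.inner hv
  have h4 : AEStronglyMeasurable
      (fun z => -(a z * inner ℝ (cross (x z) (y z)) (v z)) • cross (x z) (y z)) ν :=
    AEStronglyMeasurable.smul (f := fun z => -(a z * inner ℝ (cross (x z) (y z)) (v z)))
      (ha.mul h1).neg hc
  have h5 : AEStronglyMeasurable
      (fun z => b z • ((inner ℝ (x z) (y z) : ℝ) • v z - (inner ℝ (x z) (v z) : ℝ) • y z)) ν :=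
    hb.smul ((h2.smul hv).sub (h3.smul hy))
  exact h4.add h5

lemma aestronglyMeasurable_kernelApply {α : Type*} [MeasurableSpace α] {ν : Measure α}
    {a b : α → ℝ} {x y v : α → E3} (ha : AEStronglyMeasurable a ν)
    (hb : AEStronglyMeasurable b ν) (hx : AEStronglyMeasurable x ν)
    (hy : AEStronglyMeasurable y ν) (hv : AEStronglyMeasurable v ν) :
    AEStronglyMeasurable (fun z => kernelApply (a z) (b z) (x z) (y z) (v z)) ν :=
  (aestronglyMeasurable_divApply ha hb hx hy hv).add (aestronglyMeasurable_cross hx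
    (aestronglyMeasurable_divApply ha hb hx hy (aestronglyMeasurable_cross hv hy)))

/-- The integrand defining `convDiv`. -/
def divIntegrand (ψ : ℝ → ℝ) (F : S2 → E3) (x y : S2) : E3 :=
  divApply (deriv (kappa ψ) (inner ℝ (x : E3) y)) (kappa ψ (inner ℝ (x : E3) y)) x y (F y)

lemma IsProfile.exists_norm_le {ψ : ℝ → ℝ} (hψ : IsProfile ψ) :
    ∃ K, 0 ≤ K ∧ (∀ (F : S2 → E3) (x y : S2), ‖divIntegrand ψ F x y‖ ≤ K * ‖F y‖) ∧
      ∀ (F : S2 → E3) (x y : S2), ‖convIntegrand ψ F x y‖ ≤ K * ‖F y‖ := by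
  obtain ⟨B, hB, h1, h2⟩ := hψ.exists_bound
  refine ⟨2 * (B + 2 * B), by positivity, fun F x y => ?_, fun F x y => ?_⟩
  · refine (norm_divApply_le_of_bounds (h1 _ (inner_mem_Icc x y)) hB (h2 _) _).trans ?_
    have := norm_nonneg (F y)
    nlinarith
  · rw [convIntegrand_eq]
    exact norm_kernelApply_le_of_bounds (h1 _ (inner_mem_Icc x y)) hB (h2 _) _

lemma IsProfile.aestronglyMeasurable_divIntegrand {ψ : ℝ → ℝ} (hψ : IsProfile ψ) {F : S2 → E3}
    (hF : AEStronglyMeasurable F surfaceMeasure) (x : S2) :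
    AEStronglyMeasurable (divIntegrand ψ F x) surfaceMeasure :=
  aestronglyMeasurable_divApply
    ((measurable_deriv_kappa_inner ψ).comp measurable_prodMk_left).aestronglyMeasurable
    (hψ.continuous_kappa_inner.comp
      (by fun_prop : Continuous fun y : S2 => (x, y))).aestronglyMeasurable
    aestronglyMeasurable_const continuous_subtype_val.aestronglyMeasurable hF

lemma IsProfile.aestronglyMeasurable_convIntegrand {ψ : ℝ → ℝ} (hψ : IsProfile ψ) {F : S2 → E3}
    (hF : AEStronglyMeasurable F surfaceMeasure) (x : S2) :
    AEStronglyMeasurable (convIntegrand ψ F x) surfaceMeasure := by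
  have : convIntegrand ψ F x = _ := funext (convIntegrand_eq ψ F x)
  rw [this]
  exact aestronglyMeasurable_kernelApply
    ((measurable_deriv_kappa_inner ψ).comp measurable_prodMk_left).aestronglyMeasurable
    (hψ.continuous_kappa_inner.comp
      (by fun_prop : Continuous fun y : S2 => (x, y))).aestronglyMeasurable
    aestronglyMeasurable_const continuous_subtype_val.aestronglyMeasurable hF

lemma IsProfile.aestronglyMeasurable_convIntegrand_prod {ψ : ℝ → ℝ} (hψ : IsProfile ψ)
    {F : S2 → E3} (hF : AEStronglyMeasurable F surfaceMeasure) :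
    AEStronglyMeasurable (fun z : S2 × S2 => convIntegrand ψ F z.1 z.2)
      (surfaceMeasure.prod surfaceMeasure) := by
  simp only [convIntegrand_eq]
  exact aestronglyMeasurable_kernelApply
    (measurable_deriv_kappa_inner ψ).aestronglyMeasurable
    hψ.continuous_kappa_inner.aestronglyMeasurable
    (continuous_subtype_val.comp continuous_fst).aestronglyMeasurable
    (continuous_subtype_val.comp continuous_snd).aestronglyMeasurable hF.comp_snd

lemma IsProfile.integrable_divIntegrand {ψ : ℝ → ℝ} (hψ : IsProfile ψ) {F : S2 → E3}
    (hF : Integrable F surfaceMeasure) (x : S2) :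
    Integrable (divIntegrand ψ F x) surfaceMeasure := by
  obtain ⟨K, -, hK, -⟩ := hψ.exists_norm_le
  exact (hF.norm.const_mul K).mono' (hψ.aestronglyMeasurable_divIntegrand hF.1 x)
    (.of_forall (hK F x))

lemma IsProfile.integrable_convIntegrand {ψ : ℝ → ℝ} (hψ : IsProfile ψ) {F : S2 → E3}
    (hF : Integrable F surfaceMeasure) (x : S2) :
    Integrable (convIntegrand ψ F x) surfaceMeasure := by
  obtain ⟨K, -, -, hK⟩ := hψ.exists_norm_le
  exact (hF.norm.const_mul K).mono' (hψ.aestronglyMeasurable_convIntegrand hF.1 x)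
    (.of_forall (hK F x))

lemma IsProfile.conv_eq_convDiv {ψ : ℝ → ℝ} (hψ : IsProfile ψ) {F : S2 → E3}
    (hF : Continuous F) (x : S2) :
    conv ψ F x = convDiv ψ F x + cross x (convDiv ψ (fun y => cross (F y) y) x) := by
  have hF' : Continuous fun y : S2 => cross (F y) y :=
    continuous_cross.comp (hF.prodMk continuous_subtype_val)
  have h1 := hψ.integrable_divIntegrand (integrable_of_continuous hF) x
  have h2 := hψ.integrable_divIntegrand (integrable_of_continuous hF') x
  have h3 := (crossLeft x).integral_comp_comm h2
  have h4 := integral_add h1 ((crossLeft x).integrable_comp h2)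
  rw [h3] at h4
  rw [conv]
  simp only [convIntegrand_eq]
  exact h4

/-- The convolution operator is symmetric. -/
lemma IsProfile.fieldInner_conv {ψ : ℝ → ℝ} (hψ : IsProfile ψ) {f h : S2 → E3}
    (hf : Integrable f surfaceMeasure) (hh : Continuous h) :
    fieldInner (conv ψ f) h = fieldInner f (conv ψ h) := by
  obtain ⟨K, hK0, -, hK⟩ := hψ.exists_norm_le
  have hint : Integrable (fun z : S2 × S2 => (inner ℝ (h z.1) (convIntegrand ψ f z.1 z.2) : ℝ))
      (surfaceMeasure.prod surfaceMeasure) := by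
    refine ((((integrable_of_continuous hh).norm.mul_prod hf.norm).const_mul K).mono'
      ((hh.comp continuous_fst).aestronglyMeasurable.inner
        (hψ.aestronglyMeasurable_convIntegrand_prod hf.1)) (.of_forall fun z => ?_))
    calc _ ≤ ‖h z.1‖ * ‖convIntegrand ψ f z.1 z.2‖ := norm_inner_le_norm _ _
      _ ≤ ‖h z.1‖ * (K * ‖f z.2‖) := by gcongr; exact hK _ _ _
      _ = _ := by ring
  have h1 (x : S2) : inner ℝ (conv ψ f x) (h x) =
      ∫ y, (inner ℝ (h x) (convIntegrand ψ f x y) : ℝ) ∂surfaceMeasure := by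
    rw [real_inner_comm, conv, ← integral_inner (hψ.integrable_convIntegrand hf x)]
  have h2 (y : S2) : inner ℝ (f y) (conv ψ h y) =
      ∫ x, (inner ℝ (h x) (convIntegrand ψ f x y) : ℝ) ∂surfaceMeasure := by
    rw [conv, ← integral_inner (hψ.integrable_convIntegrand (integrable_of_continuous hh) y)]
    refine integral_congr_ae (.of_forall fun x => ?_)
    simp only [convIntegrand_eq]
    rw [← real_inner_comm (h x), inner_kernelApply, real_inner_comm (y : E3) x]
  simp only [fieldInner, h1, h2]
  exact integral_integral_swap hint

lemma IsProfile.memLp_conv {ψ : ℝ → ℝ} (hψ : IsProfile ψ) {f : S2 → E3}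
    (hf : Integrable f surfaceMeasure) : MemLp (conv ψ f) 2 surfaceMeasure := by
  obtain ⟨K, hK0, -, hK⟩ := hψ.exists_norm_le
  refine MemLp.of_bound (C := ∫ y, K * ‖f y‖ ∂surfaceMeasure)
    (hψ.aestronglyMeasurable_convIntegrand_prod hf.1).integral_prod_right' (.of_forall fun x => ?_)
  exact norm_integral_le_of_norm_le (hf.norm.const_mul K) (.of_forall (hK f x))

lemma IsProfile.inner_self_conv {ψ : ℝ → ℝ} (hψ : IsProfile ψ) {f : S2 → E3}
    (hf : Integrable f surfaceMeasure) (x : S2) : inner ℝ (x : E3) (conv ψ f x) = 0 := by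
  rw [conv, ← integral_inner (hψ.integrable_convIntegrand hf x)]
  simp [convIntegrand_eq, inner_self_kernelApply]

/-! ### From polynomial to continuous profiles. -/

/-- The operator `convDiv` depends continuously on the profile. -/
lemma norm_convDiv_sub_le {ψ₁ ψ₂ : ℝ → ℝ} (h₁ : IsProfile ψ₁) (h₂ : IsProfile ψ₂) {ε : ℝ}
    (hε : ∀ t ∈ Icc (-1 : ℝ) 1, |ψ₁ t - ψ₂ t| ≤ ε) {F : S2 → E3} (hF : Continuous F) (x : S2) :
    ‖convDiv ψ₁ F x - convDiv ψ₂ F x‖ ≤ 5 * ε * ∫ y, ‖F y‖ ∂surfaceMeasure := by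
  have hFi := integrable_of_continuous hF
  have hε0 : 0 ≤ ε := (abs_nonneg _).trans (hε 0 (by norm_num))
  have e : convDiv ψ₁ F x - convDiv ψ₂ F x = _ := (integral_sub
    (h₁.integrable_divIntegrand hFi x) (h₂.integrable_divIntegrand hFi x)).symm
  rw [e, ← integral_const_mul]
  refine norm_integral_le_of_norm_le (hFi.norm.const_mul _) (.of_forall fun y => ?_)
  rw [divIntegrand, divIntegrand, divApply_sub]
  refine (norm_divApply_le_of_bounds (h₁.abs_kappa_sub_le h₂ hε _ (inner_mem_Icc x y))
    (by positivity : 0 ≤ 3 * ε) (fun ht => h₁.abs_deriv_kappa_sub_le h₂ hε ht) _).trans_eq ?_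
  ring

lemma exists_abs_zonalCoeff_sub_le (ℓ : ℕ) : ∃ M, 0 ≤ M ∧ ∀ {ψ₁ ψ₂ : ℝ → ℝ}, Continuous ψ₁ →
    Continuous ψ₂ → ∀ {ε : ℝ}, (∀ t ∈ Icc (-1 : ℝ) 1, |ψ₁ t - ψ₂ t| ≤ ε) →
      |zonalCoeff ψ₁ ℓ - zonalCoeff ψ₂ ℓ| ≤ M * ε := by
  obtain ⟨B, hB⟩ := isCompact_Icc.exists_bound_of_continuousOn (s := Icc (-1 : ℝ) 1)
    (legendre ℓ).continuous.continuousOn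
  have hpi := Real.pi_pos
  have hB0 := (norm_nonneg _).trans (hB 0 (by norm_num))
  refine ⟨4 * Real.pi * B, by positivity, fun {ψ₁ ψ₂} h₁ h₂ {ε} hε => ?_⟩
  rw [zonalCoeff, zonalCoeff, ← mul_sub, ← intervalIntegral.integral_sub
    (Continuous.intervalIntegrable (by fun_prop) _ _)
    (Continuous.intervalIntegrable (by fun_prop) _ _), abs_mul, abs_of_pos (by positivity)]
  have hε0 : 0 ≤ ε := (abs_nonneg _).trans (hε 0 (by norm_num))
  have := intervalIntegral.norm_integral_le_of_norm_le_const (a := -1) (b := 1) (C := ε * B)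
    (f := fun t => ψ₁ t * (legendre ℓ).eval t - ψ₂ t * (legendre ℓ).eval t) fun t ht => by
      rw [uIoc_of_le (by norm_num)] at ht
      have ht' : t ∈ Icc (-1 : ℝ) 1 := ⟨ht.1.le, ht.2⟩
      rw [← sub_mul, norm_mul]
      exact mul_le_mul (hε t ht') (hB t ht') (norm_nonneg _) hε0
  rw [Real.norm_eq_abs] at this
  norm_num at this
  calc _ ≤ 2 * Real.pi * (ε * B * 2) := by gcongr
    _ = _ := by ring

lemma IsProfile.exists_polynomial {ψ : ℝ → ℝ} (hψ : IsProfile ψ) {ε : ℝ} (hε : 0 < ε) :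
    ∃ q : Polynomial ℝ, IsProfile q.eval ∧ ∀ t ∈ Icc (-1 : ℝ) 1, |ψ t - q.eval t| ≤ ε := by
  obtain ⟨q, hq, hqi⟩ := exists_polynomial_forall_abs_sub_le hψ.continuous hε
  exact ⟨q, ⟨q.continuous, hqi.trans hψ.integral_eq⟩, hq⟩

lemma IsProfile.convDiv_curlField {ψ : ℝ → ℝ} (hψ : IsProfile ψ) {ℓ : ℕ} (hℓ : ℓ ≠ 0)
    {p : Poly} (hp : IsSolidHarmonic ℓ p) (x : S2) :
    convDiv ψ (fun y => polyField (curlField p) y) x =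
      zonalCoeff ψ ℓ • polyField (curlField p) x := by
  have hF : Continuous fun y : S2 => polyField (curlField p) y :=
    (continuous_polyField _).comp continuous_subtype_val
  obtain ⟨M, hM0, hM⟩ := exists_abs_zonalCoeff_sub_le ℓ
  obtain ⟨A, hA⟩ : ∃ A, A = 5 * ∫ y : S2, ‖polyField (curlField p) y‖ ∂surfaceMeasure := ⟨_, rfl⟩
  have hA0 : 0 ≤ A := hA ▸ mul_nonneg (by norm_num) (integral_nonneg fun _ => norm_nonneg _)
  obtain ⟨N, hN⟩ : ∃ N, N = ‖polyField (curlField p) x‖ := ⟨_, rfl⟩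
  have hN0 : 0 ≤ N := hN ▸ norm_nonneg _
  refine eq_of_forall_dist_le fun δ hδ => ?_
  -- Replacing the profile costs `A * ε` in the operator and `M * N * ε` in the eigenvalue; the `1`
  -- keeps the denominator positive.
  obtain ⟨ε, hεdef⟩ : ∃ ε, ε = δ / (A + M * N + 1) := ⟨_, rfl⟩
  have hε : 0 < ε := hεdef ▸ by positivity
  obtain ⟨q, hq, hqε⟩ := hψ.exists_polynomial hε
  have h1 := norm_convDiv_sub_le hψ hq hqε hF x
  have h2 : ‖zonalCoeff q.eval ℓ • polyField (curlField p) x -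
      zonalCoeff ψ ℓ • polyField (curlField p) x‖ ≤ M * ε * N := by
    rw [hN, ← sub_smul, norm_smul, Real.norm_eq_abs, abs_sub_comm]
    exact mul_le_mul_of_nonneg_right (hM hψ.continuous hq.continuous hqε) (norm_nonneg _)
  rw [← convDiv_curlField_polynomial hq hℓ hp] at h2
  rw [dist_eq_norm]
  calc _ ≤ _ := norm_sub_le_norm_sub_add_norm_sub _ _ _
    _ ≤ _ := add_le_add h1 h2
    _ = (A + M * N) * ε := by rw [hA]; ring
    _ ≤ (A + M * N + 1) * ε := mul_le_mul_of_nonneg_right (by linarith) hε.le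
    _ = δ := by rw [hεdef]; field_simp

lemma IsProfile.convDiv_gradField {ψ : ℝ → ℝ} (hψ : IsProfile ψ) (ℓ : ℕ) (p : Poly) (x : S2) :
    convDiv ψ (fun y => polyField (gradField ℓ p) y) x = 0 := by
  have hF : Continuous fun y : S2 => polyField (gradField ℓ p) y :=
    (continuous_polyField _).comp continuous_subtype_val
  set A := ∫ y : S2, ‖polyField (gradField ℓ p) y‖ ∂surfaceMeasure with hA
  have hA0 : 0 ≤ A := integral_nonneg fun _ => norm_nonneg _
  refine eq_of_forall_dist_le fun δ hδ => ?_
  obtain ⟨q, hq, hqε⟩ := hψ.exists_polynomial (ε := δ / (5 * A + 1)) (by positivity)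
  have h1 := norm_convDiv_sub_le hψ hq hqε hF x
  rw [convDiv_gradField_polynomial hq] at h1
  rw [dist_eq_norm]
  refine h1.trans ?_
  rw [← hA, ← mul_div_assoc, div_mul_eq_mul_div, div_le_iff₀ (by positivity)]
  nlinarith

/-! ### Vector spherical harmonics -/

lemma surfaceGrad_eq {ℓ : ℕ} {p : Poly} (hp : p.IsHomogeneous ℓ) {u : S2 → ℝ}
    (hu : ∀ x : S2, u x = peval p x) (x : S2) : surfaceGrad u x = polyField (gradField ℓ p) x := by
  have hx0 : (x : E3) ≠ 0 := by
    intro h; have := norm_eq_of_mem_sphere x; simp [h] at this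
  -- By homogeneity the radial extension is `‖v‖^(-ℓ) p(v)`. Its first factor is written as a
  -- function of `‖v‖²`, and its derivative at norm `1` produces the term `-ℓ p x`.
  have h1 : HasDerivAt (fun s : ℝ => ((√s) ^ ℓ)⁻¹) (-(ℓ / 2 : ℝ)) (‖(x : E3)‖ ^ 2) := by
    rw [norm_eq_of_mem_sphere, one_pow]
    have := ((Real.hasDerivAt_sqrt one_ne_zero).fun_pow ℓ).fun_inv (by simp)
    refine this.congr_deriv ?_
    simp
    ring
  have h2 := HasDerivAt.comp_hasFDerivAt (f := fun v : E3 => ‖v‖ ^ 2) (x : E3) h1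
    (hasStrictFDerivAt_norm_sq (x : E3)).hasFDerivAt
  have h3 := h2.mul (hasFDerivAt_peval p x)
  have h4 := h3.congr_of_eventuallyEq (f₁ := radialExtension u) (by
    filter_upwards [isOpen_ne.mem_nhds hx0] with v hv
    rw [radialExtension, dif_neg hv, hu, peval_smul_of_isHomogeneous hp, inv_pow]
    simp)
  have h5 : HasGradientAt (radialExtension u) (polyField (gradField ℓ p) x) (x : E3) := by
    rw [hasGradientAt_iff_hasFDerivAt]
    refine h4.congr_fderiv ?_
    ext v
    simp [polyField, gradField, inner_eq_sum, Fin.sum_univ_three, -map_natCast]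
    ring
  exact h5.gradient

lemma continuous_polyField_coe (F : Fin 3 → Poly) : Continuous fun x : S2 => polyField F x :=
  (continuous_polyField F).comp continuous_subtype_val

lemma cross_polyField_gradField (ℓ : ℕ) (p : Poly) (x : E3) :
    cross x (polyField (gradField ℓ p) x) = polyField (curlField p) x := by
  ext i
  fin_cases i <;> simp [cross_apply_zero, cross_apply_one, cross_apply_two, polyField, gradField,
    curlField, angular_apply] <;> ring

lemma inner_polyField_gradField {ℓ : ℕ} {p : Poly} (hp : p.IsHomogeneous ℓ) (x : S2) :
    inner ℝ (x : E3) (polyField (gradField ℓ p) x) = 0 := by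
  have h := congrArg (fun q => peval q x) (sum_X_mul_pderiv hp)
  have hx := sum_sq_coe x
  simp only [peval_add, peval_mul, peval_X, peval_C] at h
  simp only [inner_eq_sum, polyField, gradField, peval_sub, peval_mul, peval_X, peval_C]
  linear_combination h - ℓ * peval p x * hx

lemma cross_cross_self {x : S2} {v : E3} (h : inner ℝ (x : E3) v = 0) :
    cross (cross x v) x = v := by
  have hx := sum_sq_coe x
  rw [inner_eq_sum] at h
  ext i
  fin_cases i <;> simp [cross_apply_zero, cross_apply_one, cross_apply_two]
  · linear_combination v 0 * hx - (x : E3) 0 * h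
  · linear_combination v 1 * hx - (x : E3) 1 * h
  · linear_combination v 2 * hx - (x : E3) 2 * h

lemma cross_polyField_curlField {ℓ : ℕ} {p : Poly} (hp : p.IsHomogeneous ℓ) (x : S2) :
    cross (polyField (curlField p) x) x = polyField (gradField ℓ p) x := by
  rw [← cross_polyField_gradField ℓ, cross_cross_self (inner_polyField_gradField hp x)]

lemma convDiv_neg (ψ : ℝ → ℝ) (F : S2 → E3) (x : S2) :
    convDiv ψ (fun y => -F y) x = -convDiv ψ F x := by
  rw [convDiv, convDiv, ← integral_neg]
  congr 1 with y : 1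
  simp only [divApply, inner_neg_right]
  module

lemma cross_zero_right (v : E3) : cross v 0 = 0 := (crossLeft v).map_zero

/-- The cross product with `y` turns the curl field into a gradient field, which the divergence-free
operator annihilates; hence only the divergence-free half acts. -/
lemma IsProfile.conv_curlField {ψ : ℝ → ℝ} (hψ : IsProfile ψ) {ℓ : ℕ} (hℓ : ℓ ≠ 0)
    {p : Poly} (hp : IsSolidHarmonic ℓ p) (x : S2) :
    conv ψ (fun y => polyField (curlField p) y) x =
      zonalCoeff ψ ℓ • polyField (curlField p) x := by
  rw [hψ.conv_eq_convDiv (continuous_polyField_coe _),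
    hψ.convDiv_curlField hℓ hp]
  simp only [cross_polyField_curlField hp.isHomogeneous, hψ.convDiv_gradField, cross_zero_right,
    add_zero]

lemma IsProfile.conv_gradField {ψ : ℝ → ℝ} (hψ : IsProfile ψ) {ℓ : ℕ} (hℓ : ℓ ≠ 0)
    {p : Poly} (hp : IsSolidHarmonic ℓ p) (x : S2) :
    conv ψ (fun y => polyField (gradField ℓ p) y) x =
      zonalCoeff ψ ℓ • polyField (gradField ℓ p) x := by
  have e (y : S2) : cross (polyField (gradField ℓ p) y) y = -polyField (curlField p) y := by
    rw [cross_swap, cross_polyField_gradField]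
  rw [hψ.conv_eq_convDiv (continuous_polyField_coe _),
    hψ.convDiv_gradField, zero_add]
  simp only [e]
  rw [convDiv_neg, hψ.convDiv_curlField hℓ hp, ← cross_polyField_curlField hp.isHomogeneous x,
    cross_swap (polyField (curlField p) x), ← crossLeft_apply, ← crossLeft_apply, map_neg, map_smul,
    smul_neg]

lemma conv_smul (ψ : ℝ → ℝ) (r : ℝ) (F : S2 → E3) (x : S2) :
    conv ψ (fun y => r • F y) x = r • conv ψ F x := by
  rw [conv, conv, ← integral_smul]
  congr 1 with y : 1
  simp only [convIntegrand]
  ext i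
  simp [Matrix.mulVec_smul]

variable {Y : (ℓ : ℕ) → Fin (2 * ℓ + 1) → S2 → ℝ}

lemma IsSphericalHarmonicBasis.exists_solidHarmonic
    (hY : IsSphericalHarmonicBasis Y) (ℓ : ℕ) (k : Fin (2 * ℓ + 1)) :
    ∃ p, IsSolidHarmonic ℓ p ∧ ∀ x : S2, Y ℓ k x = peval p x := by
  have h : Y ℓ k ∈ sphericalHarmonics ℓ := by
    rw [← hY.span_eq]
    exact Submodule.subset_span (mem_range_self k)
  obtain ⟨p, hp, hp', hu⟩ := h
  exact ⟨p, ⟨hp, hp'⟩, hu⟩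

lemma IsSphericalHarmonicBasis.exists_harmonic_eq
    (hY : IsSphericalHarmonicBasis Y) (ℓ : ℕ) (k : Fin (2 * ℓ + 1)) :
    ∃ p, IsSolidHarmonic ℓ p ∧
      harmonicDiv Y ℓ k = (fun x : S2 => (√(eigenvalue ℓ))⁻¹ • polyField (curlField p) x) ∧
      harmonicCurl Y ℓ k = fun x : S2 => (√(eigenvalue ℓ))⁻¹ • polyField (gradField ℓ p) x := by
  obtain ⟨p, hp, hu⟩ := hY.exists_solidHarmonic ℓ k
  refine ⟨p, hp, funext fun x => ?_, funext fun x => ?_⟩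
  · rw [harmonicDiv, surfaceCurl, surfaceGrad_eq hp.isHomogeneous hu, cross_polyField_gradField]
  · rw [harmonicCurl, surfaceGrad_eq hp.isHomogeneous hu]

lemma IsSphericalHarmonicBasis.continuous_harmonicDiv
    (hY : IsSphericalHarmonicBasis Y) (ℓ : ℕ) (k : Fin (2 * ℓ + 1)) :
    Continuous (harmonicDiv Y ℓ k) := by
  obtain ⟨p, -, h, -⟩ := hY.exists_harmonic_eq ℓ k
  rw [h]
  exact (continuous_polyField_coe _).const_smul (√(eigenvalue ℓ))⁻¹

lemma IsSphericalHarmonicBasis.continuous_harmonicCurl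
    (hY : IsSphericalHarmonicBasis Y) (ℓ : ℕ) (k : Fin (2 * ℓ + 1)) :
    Continuous (harmonicCurl Y ℓ k) := by
  obtain ⟨p, -, -, h⟩ := hY.exists_harmonic_eq ℓ k
  rw [h]
  exact (continuous_polyField_coe _).const_smul (√(eigenvalue ℓ))⁻¹

/-- The Funk–Hecke formula for the divergence-free vector spherical harmonics. -/
lemma IsProfile.conv_harmonicDiv {ψ : ℝ → ℝ} (hψ : IsProfile ψ) (hY : IsSphericalHarmonicBasis Y)
    {ℓ : ℕ} (hℓ : ℓ ≠ 0) (k : Fin (2 * ℓ + 1)) :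
    conv ψ (harmonicDiv Y ℓ k) = fun x => zonalCoeff ψ ℓ • harmonicDiv Y ℓ k x := by
  obtain ⟨p, hp, h, -⟩ := hY.exists_harmonic_eq ℓ k
  rw [h]
  funext x
  rw [conv_smul, hψ.conv_curlField hℓ hp, smul_comm]

/-- The Funk–Hecke formula for the curl-free vector spherical harmonics. -/
lemma IsProfile.conv_harmonicCurl {ψ : ℝ → ℝ} (hψ : IsProfile ψ) (hY : IsSphericalHarmonicBasis Y)
    {ℓ : ℕ} (hℓ : ℓ ≠ 0) (k : Fin (2 * ℓ + 1)) :
    conv ψ (harmonicCurl Y ℓ k) = fun x => zonalCoeff ψ ℓ • harmonicCurl Y ℓ k x := by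
  obtain ⟨p, hp, -, h⟩ := hY.exists_harmonic_eq ℓ k
  rw [h]
  funext x
  rw [conv_smul, hψ.conv_gradField hℓ hp, smul_comm]

/-! ### Coefficients of `C f - C² f`. -/

lemma integrable_inner_continuous {f h : S2 → E3} (hf : Integrable f surfaceMeasure)
    (hh : Continuous h) : Integrable (fun x => (inner ℝ (f x) (h x) : ℝ)) surfaceMeasure := by
  obtain ⟨C, hC⟩ := isCompact_univ.exists_bound_of_continuousOn hh.continuousOn
  refine (hf.norm.mul_const C).mono' (hf.1.inner hh.aestronglyMeasurable) (.of_forall fun x => ?_)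
  exact (norm_inner_le_norm _ _).trans
    (mul_le_mul_of_nonneg_left (hC x (mem_univ x)) (norm_nonneg _))

lemma fieldInner_sub_left {f g h : S2 → E3} (hf : Integrable f surfaceMeasure)
    (hg : Integrable g surfaceMeasure) (hh : Continuous h) :
    fieldInner (f - g) h = fieldInner f h - fieldInner g h := by
  simp only [fieldInner, Pi.sub_apply, inner_sub_left]
  exact integral_sub (integrable_inner_continuous hf hh) (integrable_inner_continuous hg hh)

lemma fieldInner_smul_right (f h : S2 → E3) (r : ℝ) :
    fieldInner f (fun x => r • h x) = r * fieldInner f h := by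
  simp only [fieldInner, inner_smul_right]
  exact integral_const_mul _ _

/-- By symmetry each application of the operator is transferred to the eigenfield `h`, so
integrability of `f` is enough. -/
lemma IsProfile.fieldInner_conv_sub_conv_conv {ψ : ℝ → ℝ} (hψ : IsProfile ψ) {f h : S2 → E3}
    (hf : Integrable f surfaceMeasure) (hh : Continuous h) {r : ℝ}
    (hr : conv ψ h = fun x => r • h x) :
    fieldInner (conv ψ f - conv ψ (conv ψ f)) h = (r - r ^ 2) * fieldInner f h := by
  have h1' := (hψ.memLp_conv hf).integrable one_le_two
  rw [fieldInner_sub_left h1' ((hψ.memLp_conv h1').integrable one_le_two) hh,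
    hψ.fieldInner_conv h1' hh, hr, fieldInner_smul_right, hψ.fieldInner_conv hf hh, hr,
    fieldInner_smul_right]
  ring

/-! ### The multipliers -/

lemma continuous_scaledZonal {φ : ℝ → ℝ} (hφ : ContinuousOn φ (Ici 0)) (c : ℝ → ℝ) {ρ : ℝ}
    (hρ : 0 < ρ) : Continuous (scaledZonal φ c ρ) := by
  refine continuous_const.mul (hφ.comp_continuous (by fun_prop) fun t => ?_)
  exact mul_nonneg (inv_nonneg.2 hρ.le) (Real.sqrt_nonneg _)

lemma IsNormalizing.isProfile {φ c : ℝ → ℝ} (hc : IsNormalizing φ c)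
    (hφ : ContinuousOn φ (Ici 0)) {ρ : ℝ} (hρ : 0 < ρ) (hρ' : ρ < 1) :
    IsProfile (scaledZonal φ c ρ) := by
  have hcont := continuous_scaledZonal hφ c hρ
  refine ⟨hcont, ?_⟩
  have h := hc ρ hρ hρ' ⟨EuclideanSpace.single 0 1, by simp⟩
  rw [integral_zonal hcont] at h
  exact eq_inv_of_mul_eq_one_right h

lemma zonalCoeff_zero (ψ : ℝ → ℝ) : zonalCoeff ψ 0 = 2 * Real.pi * ∫ t in (-1 : ℝ)..1, ψ t := by
  simp [zonalCoeff, legendre]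

lemma IsProfile.zonalCoeff_zero {ψ : ℝ → ℝ} (hψ : IsProfile ψ) : zonalCoeff ψ 0 = 1 := by
  have := Real.pi_ne_zero
  rw [SphereQI.zonalCoeff_zero, hψ.integral_eq]
  field_simp

/-- At scales bounded away from `0` and `1` each coefficient is bounded. -/
lemma IsNormalizing.exists_abs_zonalCoeff_le {φ c : ℝ → ℝ} (hc : IsNormalizing φ c)
    (hφ : ContinuousOn φ (Ici 0)) {ρ₀ ρ₁ : ℝ} (h0 : 0 < ρ₀) (h1 : ρ₁ < 1) (ℓ : ℕ) :
    ∃ B, 0 ≤ B ∧ ∀ ρ ∈ Icc ρ₀ ρ₁, |zonalCoeff (scaledZonal φ c ρ) ℓ| ≤ B := by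
  -- The absolute value extends `φ` evenly from the half-line, which makes the moment continuous in
  -- every real `r`, not only in `r = ρ⁻¹ > 0`.
  set M : ℕ → ℝ → ℝ := fun k r =>
    ∫ t in (-1 : ℝ)..1, φ |r * √(2 - 2 * t)| * (legendre k).eval t with hM
  have hφ' : Continuous fun s => φ |s| := hφ.comp_continuous continuous_abs fun s => abs_nonneg s
  have hMc (k : ℕ) : Continuous (M k) := by
    have h : Continuous (Function.uncurry fun (r t : ℝ) =>
        φ |r * √(2 - 2 * t)| * (legendre k).eval t) :=
      (hφ'.comp (by fun_prop : Continuous fun z : ℝ × ℝ => z.1 * √(2 - 2 * z.2))).mul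
        ((legendre k).continuous.comp continuous_snd)
    exact intervalIntegral.continuous_parametric_intervalIntegral_of_continuous' (μ := volume)
      (f := fun r t : ℝ => φ |r * √(2 - 2 * t)| * (legendre k).eval t) h (-1) 1
  have hw (k : ℕ) {ρ : ℝ} (hρ : 0 < ρ) :
      zonalCoeff (scaledZonal φ c ρ) k = c ρ * (2 * Real.pi * M k ρ⁻¹) := by
    have hMk : c ρ * M k ρ⁻¹ = ∫ t in (-1 : ℝ)..1,
        c ρ * (φ |ρ⁻¹ * √(2 - 2 * t)| * (legendre k).eval t) :=
      (intervalIntegral.integral_const_mul _ _).symm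
    rw [zonalCoeff, mul_left_comm, hMk]
    refine congrArg _ (intervalIntegral.integral_congr fun t _ => ?_)
    simp only [scaledZonal]
    rw [abs_of_nonneg (mul_nonneg (inv_nonneg.2 hρ.le) (Real.sqrt_nonneg _)), mul_assoc]
  have hM0 : ∀ ρ ∈ Icc ρ₀ ρ₁, c ρ * (2 * Real.pi * M 0 ρ⁻¹) = 1 := fun ρ hρ => by
    rw [← hw 0 (h0.trans_le hρ.1)]
    exact (hc.isProfile hφ (h0.trans_le hρ.1) (hρ.2.trans_lt h1)).zonalCoeff_zero
  have hinv : ContinuousOn (fun ρ : ℝ => ρ⁻¹) (Icc ρ₀ ρ₁) :=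
    continuousOn_id.inv₀ fun ρ hρ => (h0.trans_le hρ.1).ne'
  -- Nothing is known about the regularity of `c`. Normalization gives `ψ̂(0) = 1`, so the
  -- coefficient equals this ratio, from which `c` has disappeared.
  have hcont : ContinuousOn (fun ρ => M ℓ ρ⁻¹ / M 0 ρ⁻¹) (Icc ρ₀ ρ₁) := by
    refine ContinuousOn.div ((hMc ℓ).comp_continuousOn hinv) ((hMc 0).comp_continuousOn hinv)
      fun ρ hρ h => ?_
    have := hM0 ρ hρ
    rw [h] at this
    simp at this
  obtain ⟨B, hB⟩ := isCompact_Icc.exists_bound_of_continuousOn hcont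
  refine ⟨max B 0, le_max_right _ _, fun ρ hρ => ?_⟩
  refine le_trans (le_of_eq ?_) ((hB ρ hρ).trans (le_max_left _ _))
  rw [hw ℓ (h0.trans_le hρ.1), Real.norm_eq_abs]
  congr 1
  have h2 := hM0 ρ hρ
  have h3 : M 0 ρ⁻¹ ≠ 0 := fun h => by rw [h] at h2; simp at h2
  rw [eq_div_iff h3]
  linear_combination M ℓ ρ⁻¹ * h2

lemma mul_le_one_of_le_floor {ρ : ℝ} (hρ : 0 < ρ) (hρ' : ρ < 1) {ℓ : ℕ} (h : ℓ ≤ ⌊ρ⁻¹ - 1⌋₊) :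
    ((ℓ : ℝ) + 1) * ρ ≤ 1 := by
  have h1 : 0 ≤ ρ⁻¹ - 1 := sub_nonneg.2 (one_le_inv_iff₀.2 ⟨hρ, hρ'.le⟩)
  have h2 := (Nat.le_floor_iff h1).1 h
  calc ((ℓ : ℝ) + 1) * ρ ≤ ρ⁻¹ * ρ := by gcongr; linarith
    _ = 1 := inv_mul_cancel₀ hρ.ne'

lemma one_lt_mul_of_floor_lt {ρ : ℝ} (hρ : 0 < ρ) {ℓ : ℕ} (h : ⌊ρ⁻¹ - 1⌋₊ < ℓ) :
    1 < ((ℓ : ℝ) + 1) * ρ := by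
  have h2 := Nat.lt_of_floor_lt h
  calc 1 = ρ⁻¹ * ρ := (inv_mul_cancel₀ hρ.ne').symm
    _ < ((ℓ : ℝ) + 1) * ρ := by gcongr; linarith

/-- The coefficients of positive degree are bounded uniformly in the scale. -/
lemma IsNormalizing.exists_abs_zonalCoeff_le_uniform {φ c : ℝ → ℝ} (hc : IsNormalizing φ c)
    (hφ : ContinuousOn φ (Ici 0)) {m : ℝ} (hm : 0 ≤ m)
    (hψ : KernelAssumption (scaledZonal φ c) m) :
    ∃ B, 0 ≤ B ∧ ∀ ρ, 0 < ρ → ρ < 1 → ∀ ℓ : ℕ, ℓ ≠ 0 →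
      |zonalCoeff (scaledZonal φ c ρ) ℓ| ≤ B := by
  obtain ⟨ρ₀, c₁, c₂, h0, h0', hc₁, hc₂, hlow, hhigh⟩ := hψ
  -- These bounds cover `ρ ≥ ρ₀` with `1 ≤ ℓ ≤ ℓ_ρ`: there `(ℓ + 1)ρ ≤ 1` forces `ρ ≤ 1/2` and `ℓ <
  -- ρ₀⁻¹`, so finitely many degrees suffice.
  choose B hB0 hB using hc.exists_abs_zonalCoeff_le hφ h0 (ρ₁ := 1 / 2) (by norm_num)
  set N := ⌈ρ₀⁻¹⌉₊ with hN
  set S := ∑ ℓ ∈ Finset.range N, B ℓ with hS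
  have hS0 : 0 ≤ S := Finset.sum_nonneg fun ℓ _ => hB0 ℓ
  refine ⟨1 + c₁ + c₂ + S, by positivity, fun ρ hρ hρ' ℓ hℓ => ?_⟩
  rcases lt_or_ge ⌊ρ⁻¹ - 1⌋₊ ℓ with h | h
  · linarith [hhigh ρ hρ hρ' ℓ h]
  have hle := mul_le_one_of_le_floor hρ hρ' h
  have hℓ1 : (1 : ℝ) ≤ ℓ := by exact_mod_cast Nat.one_le_iff_ne_zero.2 hℓ
  rcases lt_or_ge ρ ρ₀ with hlt | hge
  · have h1 := hlow ρ hρ hlt ℓ h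
    have h2 : ((ℓ : ℝ) * ρ) ^ m ≤ 1 := Real.rpow_le_one (by positivity) (by nlinarith) hm
    have h3 : c₁ * ((ℓ : ℝ) * ρ) ^ m ≤ c₁ := mul_le_of_le_one_right hc₁.le h2
    have h4 := abs_sub_abs_le_abs_sub (zonalCoeff (scaledZonal φ c ρ) ℓ) 1
    rw [abs_sub_comm, abs_one] at h4
    linarith
  · have h1 : ρ ≤ 1 / 2 := by nlinarith
    have h2 : (ℓ : ℝ) < N := by
      refine lt_of_lt_of_le ?_ (Nat.le_ceil _)
      rw [← one_div, lt_div_iff₀ h0]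
      nlinarith
    have h3 := Finset.single_le_sum (f := B) (fun k _ => hB0 k)
      (Finset.mem_range.2 (by exact_mod_cast h2))
    linarith [hB ℓ ρ ⟨hge, h1⟩]

/-- The decay of the multipliers of `C - C²`. -/
lemma IsNormalizing.exists_multiplier_le {φ c : ℝ → ℝ} (hc : IsNormalizing φ c)
    (hφ : ContinuousOn φ (Ici 0)) {m a : ℝ} (ha : 0 ≤ a) (ham : a ≤ m)
    (hψ : KernelAssumption (scaledZonal φ c) m) :
    ∃ C, 0 < C ∧ ∀ ρ, 0 < ρ → ρ < 1 → ∀ ℓ : ℕ, ℓ ≠ 0 →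
      (zonalCoeff (scaledZonal φ c ρ) ℓ - zonalCoeff (scaledZonal φ c ρ) ℓ ^ 2) ^ 2 ≤
        (C * ρ ^ a) ^ 2 * (1 + eigenvalue ℓ) ^ a := by
  obtain ⟨B, hB0, hB⟩ := hc.exists_abs_zonalCoeff_le_uniform hφ (ha.trans ham) hψ
  obtain ⟨ρ₀, c₁, c₂, h0, h0', hc₁, -, hlow, -⟩ := hψ
  -- A lower bound for `ρ²(1 + λ_ℓ)` whenever `ρ ≥ ρ₀` or `ℓ > ℓ_ρ`. The constant `D` below adds the
  -- squared bounds for the two frequency regimes, and its `1` ensures positivity.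
  set d := ρ₀ ^ 2 / 2 with hd
  have hd0 : 0 < d := by positivity
  set D := (B * c₁) ^ 2 + (B + B ^ 2) ^ 2 / d ^ a + 1 with hD
  have hda : 0 < d ^ a := Real.rpow_pos_of_pos hd0 a
  have hD0 : 0 < D := by positivity
  refine ⟨√D, Real.sqrt_pos.2 hD0, fun ρ hρ hρ' ℓ hℓ => ?_⟩
  have hℓ1 : (1 : ℝ) ≤ ℓ := by exact_mod_cast Nat.one_le_iff_ne_zero.2 hℓ
  have he0 : 0 ≤ 1 + eigenvalue ℓ := by unfold eigenvalue; positivity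
  have hX : (√D * ρ ^ a) ^ 2 * (1 + eigenvalue ℓ) ^ a = D * (ρ ^ 2 * (1 + eigenvalue ℓ)) ^ a := by
    rw [mul_pow, Real.sq_sqrt hD0.le, Real.mul_rpow (by positivity) he0, ← Real.rpow_natCast,
      ← Real.rpow_natCast, ← Real.rpow_mul hρ.le, ← Real.rpow_mul hρ.le, mul_comm a, mul_assoc]
  rw [hX]
  have hw := hB ρ hρ hρ' ℓ hℓ
  have hlow' := hlow ρ hρ
  generalize zonalCoeff (scaledZonal φ c ρ) = w at hw hlow' ⊢
  have hw2 : (w ℓ - w ℓ ^ 2) = w ℓ * (1 - w ℓ) := by ring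
  by_cases hcase : ρ < ρ₀ ∧ ℓ ≤ ⌊ρ⁻¹ - 1⌋₊
  · have hle := mul_le_one_of_le_floor hρ hρ' hcase.2
    have hℓρ : 0 < (ℓ : ℝ) * ρ := by positivity
    have h1 := hlow' hcase.1 ℓ hcase.2
    have h2 : ((ℓ : ℝ) * ρ) ^ m ≤ ((ℓ : ℝ) * ρ) ^ a :=
      Real.rpow_le_rpow_of_exponent_ge hℓρ (by nlinarith) ham
    have h3 : (((ℓ : ℝ) * ρ) ^ a) ^ 2 ≤ (ρ ^ 2 * (1 + eigenvalue ℓ)) ^ a := by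
      rw [← Real.rpow_natCast, ← Real.rpow_mul hℓρ.le, mul_comm a, Real.rpow_mul hℓρ.le,
        Real.rpow_natCast]
      refine Real.rpow_le_rpow (by positivity) ?_ ha
      rw [mul_pow, mul_comm]
      gcongr
      unfold eigenvalue
      nlinarith
    have h4 : |w ℓ * (1 - w ℓ)| ≤ B * (c₁ * ((ℓ : ℝ) * ρ) ^ a) := by
      rw [abs_mul]
      gcongr
      exact h1.trans (by gcongr)
    rw [hw2, ← sq_abs]
    calc |w ℓ * (1 - w ℓ)| ^ 2 ≤ (B * (c₁ * ((ℓ : ℝ) * ρ) ^ a)) ^ 2 := by gcongr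
      _ = (B * c₁) ^ 2 * (((ℓ : ℝ) * ρ) ^ a) ^ 2 := by ring
      _ ≤ (B * c₁) ^ 2 * (ρ ^ 2 * (1 + eigenvalue ℓ)) ^ a := by gcongr
      _ ≤ D * (ρ ^ 2 * (1 + eigenvalue ℓ)) ^ a := by
        gcongr
        rw [hD, add_assoc]
        exact le_add_of_nonneg_right (by positivity)
  · have hXd : d ≤ ρ ^ 2 * (1 + eigenvalue ℓ) := by
      have he : ((ℓ : ℝ) + 1) ^ 2 / 2 ≤ 1 + eigenvalue ℓ := by unfold eigenvalue; nlinarith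
      rw [not_and_or, not_lt, not_le] at hcase
      rcases hcase with h | h
      · have h5 : 1 ≤ 1 + eigenvalue ℓ := by unfold eigenvalue; nlinarith
        have h6 : ρ₀ ^ 2 ≤ ρ ^ 2 := by gcongr
        rw [hd]
        nlinarith
      · have h5 := one_lt_mul_of_floor_lt hρ h
        have h6 : 1 ≤ (((ℓ : ℝ) + 1) * ρ) ^ 2 := one_le_pow₀ h5.le
        have h7 : ρ₀ ^ 2 ≤ 1 := pow_le_one₀ h0.le h0'.le
        rw [hd]
        nlinarith [mul_le_mul_of_nonneg_left he (sq_nonneg ρ)]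
    have h4 : |w ℓ - w ℓ ^ 2| ≤ B + B ^ 2 := by
      refine (abs_sub _ _).trans ?_
      rw [abs_pow]
      gcongr
    rw [← sq_abs]
    calc |w ℓ - w ℓ ^ 2| ^ 2 ≤ (B + B ^ 2) ^ 2 := by gcongr
      _ = (B + B ^ 2) ^ 2 / d ^ a * d ^ a := (div_mul_cancel₀ _ hda.ne').symm
      _ ≤ (B + B ^ 2) ^ 2 / d ^ a * (ρ ^ 2 * (1 + eigenvalue ℓ)) ^ a := by gcongr
      _ ≤ D * (ρ ^ 2 * (1 + eigenvalue ℓ)) ^ a := by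
        gcongr
        rw [hD]
        nlinarith [sq_nonneg (B * c₁)]

/-! ### Sobolev norms -/

/-- A termwise comparison in which the growth of `w` absorbs the change of exponent from `τ` to `σ`.
Working with extended norms yields finiteness for `g` along with the estimate. -/
lemma sobolevENorm_le_mul {Y : (ℓ : ℕ) → Fin (2 * ℓ + 1) → S2 → ℝ} {σ τ K : ℝ} (hK : 0 ≤ K)
    {f g : S2 → E3} {w : ℕ → ℝ}
    (hw : ∀ ℓ : ℕ, ℓ ≠ 0 → w ℓ ^ 2 ≤ K ^ 2 * (1 + eigenvalue ℓ) ^ (σ - τ))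
    (hdiv : ∀ (ℓ : ℕ) (k), ℓ ≠ 0 →
      fieldInner g (harmonicDiv Y ℓ k) = w ℓ * fieldInner f (harmonicDiv Y ℓ k))
    (hcurl : ∀ (ℓ : ℕ) (k), ℓ ≠ 0 →
      fieldInner g (harmonicCurl Y ℓ k) = w ℓ * fieldInner f (harmonicCurl Y ℓ k)) :
    sobolevENorm Y τ g ≤ ENNReal.ofReal K * sobolevENorm Y σ f := by
  have hKK : ENNReal.ofReal K = (ENNReal.ofReal (K ^ 2)) ^ (1 / 2 : ℝ) := by
    rw [ENNReal.ofReal_rpow_of_nonneg (by positivity) (by norm_num), ← Real.sqrt_eq_rpow,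
      Real.sqrt_sq hK]
  rw [sobolevENorm, sobolevENorm, hKK, ← ENNReal.mul_rpow_of_nonneg _ _ (by norm_num),
    ← ENNReal.tsum_mul_left]
  refine ENNReal.rpow_le_rpow (ENNReal.tsum_le_tsum fun ℓ => ?_) (by norm_num)
  rw [Finset.mul_sum]
  refine Finset.sum_le_sum fun k _ => ?_
  rw [← ENNReal.ofReal_mul (by positivity), hdiv _ _ ℓ.ne_zero, hcurl _ _ ℓ.ne_zero]
  refine ENNReal.ofReal_le_ofReal ?_
  have he : 0 < 1 + eigenvalue ℓ := by unfold eigenvalue; positivity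
  have h := hw ℓ ℓ.ne_zero
  rw [Real.rpow_sub he, ← mul_div_assoc, le_div_iff₀ (Real.rpow_pos_of_pos he τ)] at h
  generalize fieldInner f (harmonicDiv Y ℓ k) = p
  generalize fieldInner f (harmonicCurl Y ℓ k) = q
  nlinarith [mul_le_mul_of_nonneg_right h (add_nonneg (sq_nonneg p) (sq_nonneg q))]

end SphereQI

end

/-! ### The error estimate. -/

theorem mainTheorem5
    (Y : (ℓ : ℕ) → Fin (2 * ℓ + 1) → SphereQI.S2 → ℝ)
    (hY : SphereQI.IsSphericalHarmonicBasis Y)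
    (φ c : ℝ → ℝ) (hφ : ContinuousOn φ (Set.Ici 0))
    (hc : SphereQI.IsNormalizing φ c)
    (m σ τ : ℝ) (hψ : SphereQI.KernelAssumption (SphereQI.scaledZonal φ c) m)
    (hm : σ ≤ m) (hτ : 0 ≤ τ) (hτσ : τ ≤ σ) :
    ∃ C : ℝ, 0 < C ∧ ∀ ρ : ℝ, 0 < ρ → ρ < 1 → ∀ f : SphereQI.S2 → SphereQI.E3,
      SphereQI.MemSobolev Y σ f →
        SphereQI.ConvDefined (SphereQI.scaledZonal φ c ρ) f ∧
        SphereQI.IsL2Tangential (SphereQI.conv (SphereQI.scaledZonal φ c ρ) f) ∧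
        SphereQI.ConvDefined (SphereQI.scaledZonal φ c ρ)
          (SphereQI.conv (SphereQI.scaledZonal φ c ρ) f) ∧
        SphereQI.MemSobolev Y τ (SphereQI.conv (SphereQI.scaledZonal φ c ρ) f -
          SphereQI.conv (SphereQI.scaledZonal φ c ρ)
            (SphereQI.conv (SphereQI.scaledZonal φ c ρ) f)) ∧
        SphereQI.sobolevNorm Y τ (SphereQI.conv (SphereQI.scaledZonal φ c ρ) f -
            SphereQI.conv (SphereQI.scaledZonal φ c ρ)
              (SphereQI.conv (SphereQI.scaledZonal φ c ρ) f)) ≤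
          C * ρ ^ (σ - τ) * SphereQI.sobolevNorm Y σ f := by
  obtain ⟨C, hC, hmult⟩ := hc.exists_multiplier_le hφ (a := σ - τ) (sub_nonneg.2 hτσ)
    (by linarith) hψ
  refine ⟨C, hC, fun ρ hρ hρ' f hf => ?_⟩
  have hprof := hc.isProfile hφ hρ hρ'
  have hfi : Integrable f SphereQI.surfaceMeasure := hf.1.1.integrable one_le_two
  have hCf := hprof.memLp_conv hfi
  have hCfi := hCf.integrable one_le_two
  have hK : 0 ≤ C * ρ ^ (σ - τ) := by positivity
  have hle := SphereQI.sobolevENorm_le_mul hK (hmult ρ hρ hρ')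
    (fun ℓ k hℓ => hprof.fieldInner_conv_sub_conv_conv hfi (hY.continuous_harmonicDiv ℓ k)
      (hprof.conv_harmonicDiv hY hℓ k))
    (fun ℓ k hℓ => hprof.fieldInner_conv_sub_conv_conv hfi (hY.continuous_harmonicCurl ℓ k)
      (hprof.conv_harmonicCurl hY hℓ k))
  refine ⟨hprof.integrable_convIntegrand hfi, ⟨hCf, .of_forall (hprof.inner_self_conv hfi)⟩,
    hprof.integrable_convIntegrand hCfi, ⟨⟨hCf.sub (hprof.memLp_conv hCfi), .of_forall fun x => ?_⟩,
      hle.trans_lt (ENNReal.mul_lt_top ENNReal.ofReal_lt_top hf.2)⟩, ?_⟩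
  · rw [Pi.sub_apply, inner_sub_right, hprof.inner_self_conv hfi, hprof.inner_self_conv hCfi,
      sub_zero]
  · have := ENNReal.toReal_mono (ENNReal.mul_lt_top ENNReal.ofReal_lt_top hf.2).ne hle
    rwa [ENNReal.toReal_mul, ENNReal.toReal_ofReal hK] at this
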